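/- Let $K$ be an algebraically closed field, $K_0\subseteq K$ a perfect subfield, and $n,d$ integers with $2\le d<n$, $\gcd(n,d)=1$ and $\mathrm{char}(K_0)\nmid d$. Put $\ell_0=\lfloor (n+d)/d\rfloor$ and $m_0=d\,\ell_0$. For a polynomial $g(x)\in K_0[x]$ of degree $n$ without repeated roots, let $\mathcal C_{g,d}$ be the smooth projective model of the affine curve $y^d=g(x)$, viewed as a curve over $K_0$; let $\mathcal O_{g,d}$ be its unique infinite point. Embed $\mathcal C_{g,d}$ in its Jacobian by sending $\mathcal O_{g,d}$ to zero; the order of a point of $\mathcal C_{g,d}$ is its order in the Jacobian. Assume that $n-m_0+\ell_0=1$ and $\mathrm{char}(K_0)\nmid \ell_0$. Let $f(x)\in K_0[x]$ be a polynomial of degree $n$ without repeated roots, and let $\mathcal P\in\mathcal C_{f,d}(K)$. Then the following conditions are equivalent. (i) $\mathcal P$ is a $K_0$-point of order $m_0$ on $\mathcal C_{f,d}$. (ii) There exist nonzero $B,B_1\in K_0$ such that (a) the polynomial $f_{B,B_1}(x)=-B^d x^{m_0}+(Bx^{\ell_0}+B_1x+1)^d$ has no repeated roots; (b) there is an isomorphism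 of $K_0$-curves $\Psi:\mathcal C_{f,d}\to\mathcal C_{f_{B,B_1},d}$ that sends $\mathcal O_{f,d}$ to $\mathcal O_{f_{B,B_1},d}$ and $\mathcal P$ to $(0,1)$. Moreover, whenever $B,B_1$ and $\Psi$ are as in (ii), the point $(0,1)$ is a $K_0$-point of order $m_0$ on $\mathcal C_{f_{B,B_1},d}$, the point $\mathcal Q_d=(-1/B_1,0)$ is a $K_0$-point of order $d$ on $\mathcal C_{f_{B,B_1},d}$, and $\Psi^{-1}(\mathcal Q_d)$ is a $K_0$-point of order $d$ on $\mathcal C_{f,d}$. -/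

import Mathlib

open Polynomial
open scoped WithZero

noncomputable section

namespace CyclicCover

/-- The coordinate ring `K[x, y] / (y ^ d - f(x))` of the plane affine curve `y ^ d = f(x)`
(the outer polynomial variable is `y`, the inner one is `x`). -/
abbrev CoordinateRing {K : Type*} [Field K] (d : ℕ) (f : K[X]) : Type _ :=
  AdjoinRoot (X ^ d - C f : K[X][X])

/-- The field `K(C)` of rational functions of the curve `y ^ d = f(x)`: the fractions of its
coordinate ring (a field as soon as the coordinate ring is a domain). -/
abbrev FunctionField {K : Type*} [Field K] (d : ℕ) (f : K[X]) : Type _ :=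
  FractionRing (CoordinateRing d f)

/-- The rational function `x`. -/
def xFun {K : Type*} [Field K] (d : ℕ) (f : K[X]) : FunctionField d f :=
  algebraMap (CoordinateRing d f) (FunctionField d f) (AdjoinRoot.of _ X)

/-- The rational function `y`. -/
def yFun {K : Type*} [Field K] (d : ℕ) (f : K[X]) : FunctionField d f :=
  algebraMap (CoordinateRing d f) (FunctionField d f) (AdjoinRoot.root _)

/-- The `K`-points of the smooth projective model of `y ^ d = f(x)` over an algebraically closed
field `K`. The model is the abstract nonsingular curve of the function field `K(C)`: its points
are the normalized (i.e. surjective) discrete valuations of `K(C)` that are trivial on `K`, and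
the local ring of a point is the corresponding valuation ring. The valuation is written
multiplicatively: `val h = exp (-ord h)`. -/
structure Point {K : Type*} [Field K] (d : ℕ) (f : K[X]) where
  val : Valuation (FunctionField d f) ℤᵐ⁰
  surjective : Function.Surjective val
  trivial_on_constants : ∀ c : K, c ≠ 0 → val (algebraMap K (FunctionField d f) c) = 1

namespace Point

variable {K : Type*} [Field K] {d : ℕ} {f : K[X]}

/-- `h` is regular at `P`, i.e. `h` lies in the local ring of `P`. -/
def IsRegular (P : Point d f) (h : FunctionField d f) : Prop := P.val h ≤ 1

/-- `h` is regular at `P` and `h(P) = 0`, i.e. `h` lies in the maximal ideal of the local ring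
of `P`. -/
def Vanishes (P : Point d f) (h : FunctionField d f) : Prop := P.val h < 1

/-- The order of vanishing of a (nonzero) rational function at `P`. -/
def ord (P : Point d f) (h : FunctionField d f) : ℤ := -WithZero.log (P.val h)

/-- `P` lies above the infinite point: `x` has a pole at `P`. -/
def IsInfinite (P : Point d f) : Prop := ¬ P.IsRegular (xFun d f)

/-- `P` is the affine point `(a, b)`, i.e. `x(P) = a` and `y(P) = b`. -/
def HasCoords (P : Point d f) (a b : K) : Prop :=
  P.Vanishes (xFun d f - algebraMap K _ a) ∧ P.Vanishes (yFun d f - algebraMap K _ b)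

end Point

/-- The field `K₀(C) ⊆ K(C)` of rational functions defined over a subfield `K₀` of `K`: the
quotients of polynomials in `x` and `y` with coefficients in `K₀`. It is used only when
`f` has coefficients in `K₀`. -/
def rationalFunctions (K₀ : Type*) {K : Type*} [Field K₀] [Field K] [Algebra K₀ K]
    (d : ℕ) (f : K[X]) : Set (FunctionField d f) :=
  {h | ∃ a ∈ Algebra.adjoin K₀ {xFun d f, yFun d f}, ∃ b ∈ Algebra.adjoin K₀ {xFun d f, yFun d f},
    IsUnit b ∧ h * b = a}

/-- `P` is a `K₀`-point: every function defined over `K₀` that is regular at `P` takes at `P` a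
value in `K₀`. -/
def Point.IsRational (K₀ : Type*) {K : Type*} [Field K₀] [Field K] [Algebra K₀ K]
    {d : ℕ} {f : K[X]} (P : Point d f) : Prop :=
  ∀ h ∈ rationalFunctions K₀ d f, P.IsRegular h →
    ∃ c : K₀, P.Vanishes (h - algebraMap K₀ (FunctionField d f) c)

section Jacobian

variable {K : Type*} [Field K] (d : ℕ) (f : K[X])

/-- Divisors on the curve. -/
abbrev Divisor : Type _ := Point d f →₀ ℤ

/-- The group of principal divisors `div(g)`, `g ≠ 0` a rational function. -/
def principalDivisors : AddSubgroup (Divisor d f) where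
  carrier := {D | ∃ g : (FunctionField d f)ˣ, ∀ P : Point d f, D P = P.ord g}
  zero_mem' := ⟨1, fun P => by simp [Point.ord]⟩
  add_mem' := by
    rintro D E ⟨g, hg⟩ ⟨h, hh⟩
    refine ⟨g * h, fun P => ?_⟩
    rw [Finsupp.add_apply, hg, hh]
    simp only [Point.ord, Units.val_mul, map_mul]
    rw [WithZero.log_mul (g.isUnit.map P.val).ne_zero (h.isUnit.map P.val).ne_zero]
    ring
  neg_mem' := by
    rintro D ⟨g, hg⟩
    refine ⟨g⁻¹, fun P => ?_⟩
    have h := WithZero.log_mul (g.isUnit.map P.val).ne_zero ((g⁻¹).isUnit.map P.val).ne_zero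
    rw [← map_mul, Units.mul_inv, map_one, WithZero.log_one] at h
    rw [Finsupp.neg_apply, hg]
    simp only [Point.ord]
    linarith

/-- Divisors of degree zero. -/
def divisorsZero : AddSubgroup (Divisor d f) := (Finsupp.degree : Divisor d f →+ ℤ).ker

/-- The group of `K`-points of the jacobian (for `K` algebraically closed): divisors of degree
zero modulo principal divisors. -/
abbrev Jacobian : Type _ :=
  divisorsZero d f ⧸ (principalDivisors d f).addSubgroupOf (divisorsZero d f)

variable {d f}

/-- The canonical map of the curve to its jacobian that sends `O` to zero:
`P` goes to the class of `(P) - (O)`. -/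
def toJacobian (O P : Point d f) : Jacobian d f :=
  QuotientAddGroup.mk ⟨Finsupp.single P 1 - Finsupp.single O 1, by
    simp [divisorsZero, AddMonoidHom.mem_ker, map_sub, Finsupp.degree_single]⟩

/-- `P` is a point of order `m` on the curve, embedded in its jacobian by means of the unique
infinite point `O`. -/
def Point.HasOrder (P : Point d f) (m : ℕ) : Prop :=
  ∃ O : Point d f, (∀ Q : Point d f, Q.IsInfinite ↔ Q = O) ∧ addOrderOf (toJacobian O P) = m

end Jacobian

/-- Isomorphisms, defined over `K₀`, from the smooth projective model of `y ^ d = f(x)` to that of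
`y ^ d = g(x)`: a bijection `Ψ` on points and a `K`-isomorphism `Ψ^*` of function fields that
identify the local ring at `Ψ(P)` with the local ring at `P`, such that `Ψ^*` identifies the
functions defined over `K₀`. (The Zariski topology of an irreducible curve being the cofinite
one, `Ψ` is automatically a homeomorphism.) -/
structure Iso (K₀ : Type*) {K : Type*} [Field K₀] [Field K] [Algebra K₀ K]
    (d : ℕ) (f g : K[X]) where
  toEquiv : Point d f ≃ Point d g
  pullback : FunctionField d g ≃ₐ[K] FunctionField d f
  regular_iff : ∀ (P : Point d f) (h : FunctionField d g),
    (toEquiv P).IsRegular h ↔ P.IsRegular (pullback h)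
  defined_over : pullback '' rationalFunctions K₀ d g = rationalFunctions K₀ d f

/-- The polynomial `f_{B,B₁}(x) = -B ^ d x ^ {dℓ} + (B x ^ ℓ + B₁ x + 1) ^ d`. -/
def versalPoly {K₀ : Type*} [Field K₀] (d ℓ : ℕ) (B B₁ : K₀) : K₀[X] :=
  -C (B ^ d) * X ^ (d * ℓ) + (C B * X ^ ℓ + C B₁ * X + 1) ^ d

/-- `Ψ` sends the infinite point to the infinite point and `P` to the affine point `(0, 1)`. -/
def Iso.Normalizes {K₀ K : Type*} [Field K₀] [Field K] [Algebra K₀ K]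
    {d : ℕ} {f g : K[X]} (Ψ : Iso K₀ d f g) (P : Point d f) : Prop :=
  (∀ O : Point d f, O.IsInfinite → (Ψ.toEquiv O).IsInfinite) ∧ (Ψ.toEquiv P).HasCoords 0 1

end CyclicCover

end

/-!
The condition `n - m₀ + ℓ = 1` says that `n = (d - 1) ℓ + 1` with `2 ≤ ℓ ≤ d`, so that
`n < m₀ = d ℓ < n + d ≤ 2 n`.

The functions `x` and `y` have their only pole at the infinite point `O`, of orders `d` and `n`. A
function without other poles is a polynomial in `x` and `y`, and as `d` and `n` are coprime its
pole order is a weighted degree. So a function with a pole of order less than `n` is a polynomial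
in `x`; it has a single zero only at a point with `y = 0`, since otherwise it also vanishes at the
conjugates `(a, ζ b)` of its zero `(a, b)` (`eq_zero_of_nsmul_eq_zero`). A function with a pole of
order `d ℓ` has the form `A(x) + c y` with `deg A = ℓ`.

If `P = (a, b)` has order `d ℓ`, then `b ≠ 0`, because the points with `y = 0` have order `d`
(`Point.HasCoords.hasOrder_of_eq_zero`), and `d ℓ (P) - d ℓ (O)` is the divisor of a function
`y - A(x)`. As `x - a` is a local parameter at `P`, the power `(x - a) ^ (d ℓ)` divides the
polynomial `f - A ^ d = y ^ d - A ^ d`, whose degree is at most `d ℓ`, hence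
`f = A ^ d + c (x - a) ^ (d ℓ)` (`exists_eq_pow_add`). Since `deg f = (d - 1) ℓ + 1`, the polynomial
`A` is the sum of a multiple of `(x - a) ^ ℓ` and a polynomial of degree `1`
(`exists_eq_of_eq_pow_add`), its coefficients can be read off from those of `f` and thus lie in `K₀`
(`exists_descent`), and `x ↦ x - a`, `y ↦ y / b` is the required isomorphism (`exists_iso`).

Conversely, on `y ^ d = f_{B, B₁}(x)` the function `y - (B x ^ ℓ + B₁ x + 1)` has divisor
`d ℓ (P) - d ℓ (O)` for `P = (0, 1)` (`nsmul_eq_zero_of_eq_pow_add`), and a proper divisor of `d ℓ`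
is less than `n`, so that it is not the order of `P`.

A point of the model is a normalized valuation, so points have to be constructed. At each `(a, b)`
the curve has the explicit local parameter `x - a` or `y` (`exists_localParameter`). Therefore the
coordinate ring is a Dedekind domain, and the affine points are its maximal ideals. With constants
in `K₀` instead of `K`, the same local parameter shows that a point with coordinates in `K₀` is a
`K₀`-point. A valuation with a pole of `x` exists by domination and is determined by weighted
degrees, which gives the infinite point. Isomorphisms preserve orders because normalized
discrete valuations with the same valuation ring are equal (`eq_of_val_le_one_iff`).
-/

open Polynomial
open scoped WithZero

noncomputable section

namespace CyclicCover

/-! ### Local parameters on the affine curve -/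

section LocalParameter

variable {k A : Type*} [Field k] [CommRing A] [Algebra k A]

theorem aeval_mem_subalgebra {S : Subalgebra k A} {z : A} (hz : z ∈ S) (p : k[X]) :
    aeval z p ∈ S :=
  Algebra.adjoin_le (Set.singleton_subset_iff.2 hz) (aeval_mem_adjoin_singleton k z)

theorem exists_eq_const_add (x y : A) (a b : k) {r : A} (hr : r ∈ Algebra.adjoin k {x, y}) :
    ∃ c : k, ∃ u ∈ Algebra.adjoin k {x, y}, ∃ v ∈ Algebra.adjoin k {x, y},
      r = algebraMap k A c + u * (x - algebraMap k A a) + v * (y - algebraMap k A b) := by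
  set S := Algebra.adjoin k {x, y} with hS
  induction hr using Algebra.adjoin_induction with
  | mem z hz =>
    rcases hz with rfl | rfl
    · exact ⟨a, 1, one_mem _, 0, zero_mem _, by ring⟩
    · exact ⟨b, 0, zero_mem _, 1, one_mem _, by ring⟩
  | algebraMap c => exact ⟨c, 0, zero_mem _, 0, zero_mem _, by ring⟩
  | add r s _ _ hr hs =>
    obtain ⟨c, u, hu, v, hv, rfl⟩ := hr
    obtain ⟨c', u', hu', v', hv', rfl⟩ := hs
    exact ⟨c + c', u + u', add_mem hu hu', v + v', add_mem hv hv', by rw [map_add]; ring⟩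
  | mul r s hr' hs' hr hs =>
    obtain ⟨c, u, hu, v, hv, h⟩ := hr
    obtain ⟨c', u', hu', v', hv', h'⟩ := hs
    refine ⟨c * c', u * s + algebraMap k A c * u', ?_, v * s + algebraMap k A c * v', ?_, ?_⟩
    · exact add_mem (mul_mem hu hs') (mul_mem (S.algebraMap_mem c) hu')
    · exact add_mem (mul_mem hv hs') (mul_mem (S.algebraMap_mem c) hv')
    · rw [map_mul]
      linear_combination s * h + algebraMap k A c * h'

open Classical in
/-- A generator of the maximal ideal `(x - a, y - b)` near the point `(a, b)` of the curve
`y ^ d = f(x)`: the function `y` if `b = 0`, and `x - a` otherwise. -/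
def localParameter (x y : A) (a b : k) : A := if b = 0 then y else x - algebraMap k A a

theorem localParameter_zero (x y : A) (a : k) : localParameter x y a 0 = y := if_pos rfl

theorem localParameter_of_ne (x y : A) (a : k) {b : k} (hb : b ≠ 0) :
    localParameter x y a b = x - algebraMap k A a := if_neg hb

/-- Near the point `(a, b)` of the smooth curve `y ^ d = f(x)` the maximal ideal `(x - a, y - b)`
is generated by `localParameter x y a b`, once the function `s`, which takes the nonzero value `e`
at `(a, b)`, is inverted. The functions `p(y) = (y ^ d - b ^ d) / (y - b)` and
`q(x) = (f(x) - f(a)) / (x - a)` satisfy `q(x) (x - a) = p(y) (y - b)`, and one of them does not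
vanish at `(a, b)`. -/
theorem exists_localParameter {d : ℕ} {f : k[X]} {x y : A} {a b : k} (hd : (d : k) ≠ 0)
    (hf : f.Separable) (hxy : y ^ d = aeval x f) (hab : b ^ d = f.eval a) :
    ∃ s ∈ Algebra.adjoin k {x, y}, ∃ e : k, e ≠ 0 ∧ ∃ u ∈ Algebra.adjoin k {x, y},
      ∃ v ∈ Algebra.adjoin k {x, y},
      s = algebraMap k A e + u * (x - algebraMap k A a) + v * (y - algebraMap k A b) ∧
      ∀ r ∈ Algebra.adjoin k {x, y}, ∃ c : k, ∃ r' ∈ Algebra.adjoin k {x, y},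
        s * (r - algebraMap k A c) = localParameter x y a b * r' := by
  set S := Algebra.adjoin k {x, y} with hS
  have hx : x ∈ S := Algebra.subset_adjoin (by simp)
  have hy : y ∈ S := Algebra.subset_adjoin (by simp)
  have hdpos : d ≠ 0 := by rintro rfl; simp at hd
  obtain ⟨q, hq⟩ : (X - C a) ∣ f - C (f.eval a) := X_sub_C_dvd_sub_C_eval
  obtain ⟨p, hp⟩ : (X - C b) ∣ (X ^ d - C (b ^ d) : k[X]) := by
    simpa using X_sub_C_dvd_sub_C_eval (a := b) (p := (X ^ d : k[X]))
  have hqa : q.eval a = f.derivative.eval a := by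
    have := congrArg (fun p => (derivative p).eval a) hq
    simpa using this.symm
  have hpb : p.eval b = d * b ^ (d - 1) := by
    have := congrArg (fun p => (derivative p).eval b) hp
    rw [derivative_sub, derivative_C, sub_zero, derivative_X_pow, derivative_mul] at this
    simpa using this.symm
  have key : aeval x q * (x - algebraMap k A a) = aeval y p * (y - algebraMap k A b) := by
    have h1 := congrArg (aeval x) hq
    have h2 := congrArg (aeval y) hp
    simp only [map_sub, map_mul, aeval_X, aeval_C, map_pow] at h1 h2
    rw [← hab, map_pow] at h1
    linear_combination -h1 + h2 - hxy
  by_cases hb : b = 0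
  · have hfa : f.eval a = 0 := by rw [← hab, hb, zero_pow hdpos]
    have he : q.eval a ≠ 0 := by
      rw [hqa]
      exact hf.eval₂_derivative_ne_zero (RingHom.id k) (by simpa using hfa)
    obtain ⟨q', hq'⟩ : (X - C a) ∣ q - C (q.eval a) := X_sub_C_dvd_sub_C_eval
    refine ⟨aeval x q, aeval_mem_subalgebra hx q, q.eval a, he, aeval x q',
      aeval_mem_subalgebra hx q', 0, zero_mem _, ?_, fun r hr => ?_⟩
    · have h1 := congrArg (aeval x) hq'
      simp only [map_sub, map_mul, aeval_X, aeval_C] at h1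
      linear_combination h1
    · obtain ⟨c, u, hu, v, hv, rfl⟩ := exists_eq_const_add x y a b hr
      refine ⟨c, u * aeval y p + v * aeval x q,
        add_mem (mul_mem hu (aeval_mem_subalgebra hy p))
          (mul_mem hv (aeval_mem_subalgebra hx q)), ?_⟩
      subst hb
      rw [localParameter_zero]
      rw [map_zero, sub_zero] at key ⊢
      linear_combination u * key
  · have he : p.eval b ≠ 0 := by
      rw [hpb]
      exact mul_ne_zero hd (pow_ne_zero _ hb)
    obtain ⟨p', hp'⟩ : (X - C b) ∣ p - C (p.eval b) := X_sub_C_dvd_sub_C_eval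
    refine ⟨aeval y p, aeval_mem_subalgebra hy p, p.eval b, he, 0, zero_mem _, aeval y p',
      aeval_mem_subalgebra hy p', ?_, fun r hr => ?_⟩
    · have h1 := congrArg (aeval y) hp'
      simp only [map_sub, map_mul, aeval_X, aeval_C] at h1
      linear_combination h1
    · obtain ⟨c, u, hu, v, hv, rfl⟩ := exists_eq_const_add x y a b hr
      refine ⟨c, u * aeval y p + v * aeval x q,
        add_mem (mul_mem hu (aeval_mem_subalgebra hy p))
          (mul_mem hv (aeval_mem_subalgebra hx q)), ?_⟩
      rw [localParameter_of_ne _ _ _ hb]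
      linear_combination -v * key

end LocalParameter

/-! ### Valuations centred at an affine point -/

section Centered

variable {k L : Type*} [Field k] [Field L] [Algebra k L]

/-- The valuation `w` of the field `L` is trivial on the constants `k` and is centred at the point
`(a, b)` of the plane, with respect to the elements `x`, `y` of `L`. -/
structure IsCentered (w : Valuation L ℤᵐ⁰) (x y : L) (a b : k) : Prop where
  map_const : ∀ c : k, c ≠ 0 → w (algebraMap k L c) = 1
  lt_left : w (x - algebraMap k L a) < 1
  lt_right : w (y - algebraMap k L b) < 1

namespace IsCentered

variable {w : Valuation L ℤᵐ⁰} {x y : L} {a b : k}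

theorem map_const_le (h : IsCentered w x y a b) (c : k) : w (algebraMap k L c) ≤ 1 := by
  by_cases hc : c = 0
  · simp [hc]
  · exact (h.map_const c hc).le

theorem eq_zero_of_lt (h : IsCentered w x y a b) {c : k} (hc : w (algebraMap k L c) < 1) :
    c = 0 := by
  by_contra h0
  exact hc.ne (h.map_const c h0)

theorem map_le_one (h : IsCentered w x y a b) {r : L} (hr : r ∈ Algebra.adjoin k {x, y}) :
    w r ≤ 1 := by
  have aux : ∀ (z : L) (c : k), w (z - algebraMap k L c) < 1 → w z ≤ 1 := fun z c hz => by
    have := w.map_add_le hz.le (h.map_const_le c)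
    simpa using this
  induction hr using Algebra.adjoin_induction with
  | mem z hz =>
    rcases hz with rfl | rfl
    · exact aux _ _ h.lt_left
    · exact aux _ _ h.lt_right
  | algebraMap c => exact h.map_const_le c
  | add r s _ _ hr hs => exact w.map_add_le hr hs
  | mul r s _ _ hr hs => rw [map_mul]; exact mul_le_one' hr hs

theorem map_comb_lt (h : IsCentered w x y a b) {u v : L} (hu : u ∈ Algebra.adjoin k {x, y})
    (hv : v ∈ Algebra.adjoin k {x, y}) :
    w (u * (x - algebraMap k L a) + v * (y - algebraMap k L b)) < 1 := by
  refine w.map_add_lt ?_ ?_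
  · rw [map_mul]; exact (mul_le_of_le_one_left' (h.map_le_one hu)).trans_lt h.lt_left
  · rw [map_mul]; exact (mul_le_of_le_one_left' (h.map_le_one hv)).trans_lt h.lt_right

theorem map_localParameter_lt (h : IsCentered w x y a b) : w (localParameter x y a b) < 1 := by
  rcases eq_or_ne b 0 with rfl | hb
  · simpa [localParameter_zero] using h.lt_right
  · simpa [localParameter_of_ne x y a hb] using h.lt_left

theorem map_eq_one (h : IsCentered w x y a b) {c : k} (hc : c ≠ 0) {r : L}
    (hr : w (r - algebraMap k L c) < 1) : w r = 1 := by
  rw [← h.map_const c hc] at hr ⊢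
  exact w.map_eq_of_sub_lt (by simpa using hr)

theorem exists_sub_const_lt (h : IsCentered w x y a b) {r : L}
    (hr : r ∈ Algebra.adjoin k {x, y}) : ∃ c : k, w (r - algebraMap k L c) < 1 := by
  obtain ⟨c, u, hu, v, hv, rfl⟩ := exists_eq_const_add x y a b hr
  refine ⟨c, ?_⟩
  rw [add_assoc, add_sub_cancel_left]
  exact h.map_comb_lt hu hv

variable {d : ℕ} {f : k[X]}

theorem pow_eq_eval (h : IsCentered w x y a b) (hxy : y ^ d = aeval x f) : b ^ d = f.eval a := by
  obtain ⟨q, hq⟩ : (X - C a) ∣ f - C (f.eval a) := X_sub_C_dvd_sub_C_eval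
  obtain ⟨p, hp⟩ : (X - C b) ∣ (X ^ d - C (b ^ d) : k[X]) := by
    simpa using X_sub_C_dvd_sub_C_eval (a := b) (p := (X ^ d : k[X]))
  have hx : x ∈ Algebra.adjoin k {x, y} := Algebra.subset_adjoin (by simp)
  have hy : y ∈ Algebra.adjoin k {x, y} := Algebra.subset_adjoin (by simp)
  have h1 := congrArg (aeval x) hq
  have h2 := congrArg (aeval y) hp
  simp only [map_sub, map_mul, aeval_X, aeval_C] at h1 h2
  rw [map_pow, aeval_X] at h2
  have h3 := h.map_comb_lt (aeval_mem_subalgebra hx q) (neg_mem (aeval_mem_subalgebra hy p))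
  refine sub_eq_zero.1 (h.eq_zero_of_lt ?_)
  convert h3 using 2
  rw [map_sub]
  linear_combination h1 - h2 + hxy

/-- At a smooth point `(a, b)`, every nonzero polynomial function `r` is a power of the local
parameter up to functions that do not vanish at the point. The exponent and the two functions
serve all valuations centred at `(a, b)`. -/
theorem exists_mul_eq_pow_mul (hd : (d : k) ≠ 0) (hf : f.Separable) (hxy : y ^ d = aeval x f)
    (h : IsCentered w x y a b) {r : L} (hr : r ∈ Algebra.adjoin k {x, y}) (hr0 : r ≠ 0) :
    ∃ m : ℕ, ∃ t ∈ Algebra.adjoin k {x, y}, ∃ r' ∈ Algebra.adjoin k {x, y},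
      (∀ w' : Valuation L ℤᵐ⁰, IsCentered w' x y a b → w' t = 1 ∧ w' r' = 1) ∧
      t * r = localParameter x y a b ^ m * r' := by
  obtain ⟨s, hs, e, he, u, hu, v, hv, hse, hS⟩ :=
    exists_localParameter hd hf hxy (h.pow_eq_eval hxy)
  set π := localParameter x y a b with hπ
  have hπw : ∀ w' : Valuation L ℤᵐ⁰, IsCentered w' x y a b → w' π < 1 := fun w' h' => by
    exact h'.map_localParameter_lt
  have hsw : ∀ w' : Valuation L ℤᵐ⁰, IsCentered w' x y a b → w' s = 1 := fun w' h' => by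
    refine h'.map_eq_one he ?_
    rw [hse, add_assoc, add_sub_cancel_left]
    exact h'.map_comb_lt hu hv
  -- The order of vanishing at `w` bounds the number of factors `π` that can be extracted.
  have main : ∀ N : ℕ, ∀ r ∈ Algebra.adjoin k {x, y}, r ≠ 0 → -WithZero.log (w r) ≤ N →
      ∃ m : ℕ, ∃ t ∈ Algebra.adjoin k {x, y}, ∃ r' ∈ Algebra.adjoin k {x, y},
      (∀ w' : Valuation L ℤᵐ⁰, IsCentered w' x y a b → w' t = 1 ∧ w' r' = 1) ∧
      t * r = π ^ m * r' := by
    intro N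
    induction N with
    | zero =>
      intro r hr hr0 hN
      have hw1 : w r = 1 := by
        refine le_antisymm (h.map_le_one hr) ?_
        have : (0 : ℤ) ≤ WithZero.log (w r) := by simpa using hN
        rwa [WithZero.le_log_iff_exp_le (w.ne_zero_iff.2 hr0), WithZero.exp_zero] at this
      obtain ⟨c, r', hr', hc⟩ := hS r hr
      have hc0 : c ≠ 0 := by
        rintro rfl
        have h1 := congrArg w hc
        simp only [map_zero, sub_zero, map_mul, hw1, hsw w h, one_mul] at h1
        exact absurd h1.symm ((mul_le_of_le_one_right' (h.map_le_one hr')).trans_lt (hπw w h)).ne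
      refine ⟨0, 1, one_mem _, r, hr, fun w' h' => ⟨map_one _, h'.map_eq_one hc0 ?_⟩, by simp⟩
      have h1 := congrArg w' hc
      rw [map_mul, hsw w' h', one_mul, map_mul] at h1
      rw [h1]
      exact (mul_le_of_le_one_right' (h'.map_le_one hr')).trans_lt (hπw w' h')
    | succ N ih =>
      intro r hr hr0 hN
      obtain ⟨c, r', hr', hc⟩ := hS r hr
      by_cases hc0 : c = 0
      · subst hc0
        rw [map_zero, sub_zero] at hc
        have hs0 : s ≠ 0 := fun h0 => by simpa [h0] using hsw w h
        have hne : π * r' ≠ 0 := hc ▸ mul_ne_zero hs0 hr0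
        have hr'0 := right_ne_zero_of_mul hne
        have hπ0 := left_ne_zero_of_mul hne
        have h1 := congrArg (fun z => WithZero.log (w z)) hc
        simp only [map_mul, hsw w h, one_mul] at h1
        rw [WithZero.log_mul (w.ne_zero_iff.2 hπ0) (w.ne_zero_iff.2 hr'0)] at h1
        have h2 : WithZero.log (w π) < 0 := by
          rw [WithZero.log_lt_iff_lt_exp (w.ne_zero_iff.2 hπ0)]
          exact hπw w h
        obtain ⟨m, t, ht, r'', hr'', hu', heq⟩ := ih r' hr' hr'0 (by push_cast at hN; omega)
        refine ⟨m + 1, t * s, mul_mem ht hs, r'', hr'', fun w' h' => ⟨?_, (hu' w' h').2⟩, ?_⟩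
        · rw [map_mul, (hu' w' h').1, hsw w' h', one_mul]
        · rw [pow_succ]
          linear_combination t * hc + π * heq
      · refine ⟨0, 1, one_mem _, r, hr, fun w' h' => ⟨map_one _, h'.map_eq_one hc0 ?_⟩, by simp⟩
        have h1 := congrArg w' hc
        rw [map_mul, hsw w' h', one_mul, map_mul] at h1
        rw [h1]
        exact (mul_le_of_le_one_right' (h'.map_le_one hr')).trans_lt (hπw w' h')
  refine main (-WithZero.log (w r)).toNat r hr hr0 (Int.self_le_toNat _)

theorem exists_map_eq_pow (hd : (d : k) ≠ 0) (hf : f.Separable) (hxy : y ^ d = aeval x f)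
    (h : IsCentered w x y a b) {r : L} (hr : r ∈ Algebra.adjoin k {x, y}) (hr0 : r ≠ 0) :
    ∃ m : ℕ, ∀ w' : Valuation L ℤᵐ⁰, IsCentered w' x y a b →
      w' r = w' (localParameter x y a b) ^ m := by
  obtain ⟨m, t, -, r', -, hu, heq⟩ := exists_mul_eq_pow_mul hd hf hxy h hr hr0
  refine ⟨m, fun w' h' => ?_⟩
  have := congrArg w' heq
  rwa [map_mul, map_mul, (hu w' h').1, (hu w' h').2, one_mul, mul_one, map_pow] at this

/-- A normalized valuation of the function field takes the value `exp (-1)` at the local parameter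
of its centre. -/
theorem map_localParameter (hd : (d : k) ≠ 0) (hf : f.Separable) (hxy : y ^ d = aeval x f)
    (h : IsCentered w x y a b) (hsurj : Function.Surjective w)
    (hfrac : ∀ z : L, ∃ p ∈ Algebra.adjoin k {x, y}, ∃ q ∈ Algebra.adjoin k {x, y},
      q ≠ 0 ∧ z * q = p) :
    w (localParameter x y a b) = WithZero.exp (-1) := by
  set π := localParameter x y a b with hπ
  have hπw : w π < 1 := by
    exact h.map_localParameter_lt
  obtain ⟨z, hz⟩ := hsurj (WithZero.exp (-1))
  obtain ⟨p, hp, q, hq, hq0, hzq⟩ := hfrac z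
  have hz0 : z ≠ 0 := by
    rintro rfl
    rw [map_zero] at hz
    exact WithZero.exp_ne_zero hz.symm
  have hp0 : p ≠ 0 := hzq ▸ mul_ne_zero hz0 hq0
  obtain ⟨m, hm⟩ := exists_map_eq_pow hd hf hxy h hp hp0
  obtain ⟨l, hl⟩ := exists_map_eq_pow hd hf hxy h hq hq0
  have hmw := hm w h
  have hlw := hl w h
  have h1 := congrArg (fun z => WithZero.log (w z)) hzq
  simp only [map_mul] at h1
  rw [WithZero.log_mul (w.ne_zero_iff.2 hz0) (w.ne_zero_iff.2 hq0), hz, hmw, hlw,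
    WithZero.log_exp, ← hπ, WithZero.log_pow, WithZero.log_pow] at h1
  have hne : w π ≠ 0 := by
    intro h0
    rw [← hπ, h0] at hmw hlw
    have hm0 : m = 0 := by
      by_contra hm0; rw [zero_pow hm0] at hmw; exact hp0 (w.zero_iff.1 hmw)
    have hl0 : l = 0 := by
      by_contra hl0; rw [zero_pow hl0] at hlw; exact hq0 (w.zero_iff.1 hlw)
    simp [hm0, hl0] at h1
  have h2 : WithZero.log (w π) < 0 := by
    rw [WithZero.log_lt_iff_lt_exp hne]; exact hπw
  have h3 : WithZero.log (w π) = -1 := by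
    have h4 : WithZero.log (w π) ∣ 1 := ⟨l - m, by simp only [nsmul_eq_mul] at h1; linarith⟩
    rcases Int.isUnit_iff.1 (isUnit_of_dvd_one h4) with h5 | h5 <;> omega
  rw [← h3, WithZero.exp_log hne]

/-- There is at most one normalized valuation of the function field centred at `(a, b)`. -/
theorem eq_of_isCentered (hd : (d : k) ≠ 0) (hf : f.Separable) (hxy : y ^ d = aeval x f)
    {w' : Valuation L ℤᵐ⁰} (h : IsCentered w x y a b) (h' : IsCentered w' x y a b)
    (hsurj : Function.Surjective w) (hsurj' : Function.Surjective w')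
    (hfrac : ∀ z : L, ∃ p ∈ Algebra.adjoin k {x, y}, ∃ q ∈ Algebra.adjoin k {x, y},
      q ≠ 0 ∧ z * q = p) : w = w' := by
  have hS : ∀ r ∈ Algebra.adjoin k {x, y}, w r = w' r := fun r hr => by
    by_cases hr0 : r = 0
    · simp [hr0]
    · obtain ⟨m, hm⟩ := exists_map_eq_pow hd hf hxy h hr hr0
      rw [hm w h, hm w' h', map_localParameter hd hf hxy h hsurj hfrac,
        map_localParameter hd hf hxy h' hsurj' hfrac]
  ext z
  obtain ⟨p, hp, q, hq, hq0, hzq⟩ := hfrac z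
  have h1 : w z * w q = w p := by rw [← map_mul, hzq]
  have h2 : w' z * w' q = w' p := by rw [← map_mul, hzq]
  rw [hS p hp, ← h2, hS q hq] at h1
  exact mul_right_cancel₀ (w'.ne_zero_iff.2 hq0) h1

/-- A function that is regular at the point `(a, b)` and is a quotient of polynomials in `x` and
`y` over `k` takes a value in `k` there, if `a, b ∈ k`. -/
theorem exists_sub_const_lt_of_frac (hd : (d : k) ≠ 0) (hf : f.Separable)
    (hxy : y ^ d = aeval x f) (h : IsCentered w x y a b) {z p q : L}
    (hp : p ∈ Algebra.adjoin k {x, y}) (hq : q ∈ Algebra.adjoin k {x, y}) (hq0 : q ≠ 0)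
    (hz : z * q = p) (hz1 : w z ≤ 1) : ∃ c : k, w (z - algebraMap k L c) < 1 := by
  rcases hz1.lt_or_eq with hlt | heq
  · exact ⟨0, by simpa using hlt⟩
  have hz0 : z ≠ 0 := fun h0 => by simp [h0] at heq
  have hp0 : p ≠ 0 := hz ▸ mul_ne_zero hz0 hq0
  obtain ⟨m, t, ht, p', hp', hu, hpe⟩ := exists_mul_eq_pow_mul hd hf hxy h hp hp0
  obtain ⟨l, s, hs, q', hq', hv, hqe⟩ := exists_mul_eq_pow_mul hd hf hxy h hq hq0
  set π := localParameter x y a b with hπ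
  have hπw : w π < 1 := by
    exact h.map_localParameter_lt
  have hs0 : s ≠ 0 := fun h0 => by simpa [h0] using (hv w h).1
  have ht0 : t ≠ 0 := fun h0 => by simpa [h0] using (hu w h).1
  have hne : π ^ m ≠ 0 := left_ne_zero_of_mul (hpe ▸ mul_ne_zero ht0 hp0)
  have hne' : π ^ l ≠ 0 := left_ne_zero_of_mul (hqe ▸ mul_ne_zero hs0 hq0)
  have hpw : w p = w q := by rw [← hz, map_mul, heq, one_mul]
  have e1 : w p = w π ^ m := by
    have := congrArg w hpe
    rwa [map_mul, map_mul, (hu w h).1, (hu w h).2, one_mul, mul_one, map_pow] at this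
  have e2 : w q = w π ^ l := by
    have := congrArg w hqe
    rwa [map_mul, map_mul, (hv w h).1, (hv w h).2, one_mul, mul_one, map_pow] at this
  have hml : m = l := by
    have h1 : w π ^ m = w π ^ l := by rw [← e1, ← e2, hpw]
    by_cases hπ0 : w π = 0
    · have hm0 : m = 0 := by
        by_contra hm0; exact hne (by rw [w.zero_iff.1 hπ0, zero_pow hm0])
      have hl0 : l = 0 := by
        by_contra hl0; exact hne' (by rw [w.zero_iff.1 hπ0, zero_pow hl0])
      rw [hm0, hl0]
    · have h2 := congrArg WithZero.log h1
      rw [WithZero.log_pow, WithZero.log_pow] at h2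
      have h3 : WithZero.log (w π) < 0 := by
        rw [WithZero.log_lt_iff_lt_exp hπ0]; exact hπw
      simp only [nsmul_eq_mul] at h2
      exact_mod_cast mul_right_cancel₀ h3.ne h2
  subst hml
  have e3 : z * (t * q') = s * p' := by
    have h4 : π ^ m * (z * (t * q')) = π ^ m * (s * p') := by
      linear_combination s * hpe - z * t * hqe + s * t * hz
    exact mul_left_cancel₀ hne h4
  obtain ⟨c, hc⟩ := h.exists_sub_const_lt (mul_mem ht hq')
  obtain ⟨c', hc'⟩ := h.exists_sub_const_lt (mul_mem hs hp')
  have hw1 : w (t * q') = 1 := by rw [map_mul, (hu w h).1, (hv w h).2, one_mul]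
  have hc0 : c ≠ 0 := by
    rintro rfl
    simp only [map_zero, sub_zero] at hc
    exact hc.ne hw1
  refine ⟨c' / c, ?_⟩
  have hcL : algebraMap k L c ≠ 0 := by simpa using hc0
  have e4 : (z - algebraMap k L (c' / c)) * algebraMap k L c =
      (s * p' - algebraMap k L c') - z * (t * q' - algebraMap k L c) := by
    rw [map_div₀]
    field_simp
    linear_combination e3
  have e5 := congrArg w e4
  rw [map_mul, h.map_const c hc0, mul_one] at e5
  rw [e5]
  refine w.map_sub_lt hc' ?_
  rw [map_mul, heq, one_mul]
  exact hc

end IsCentered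

end Centered

/-! ### The coordinate ring and the function field -/

/-- The curve `y ^ d = f(x)` is smooth and tamely and totally ramified at infinity: `f` is
separable of degree prime to `d`, and `d ≥ 2` is invertible in `K`. -/
structure IsAdmissible {K : Type*} [Field K] (d : ℕ) (f : K[X]) : Prop where
  two_le : 2 ≤ d
  coprime : f.natDegree.Coprime d
  cast_ne_zero : (d : K) ≠ 0
  separable : f.Separable

section Curve

variable {K : Type*} [Field K] {d : ℕ} {f : K[X]}

theorem IsAdmissible.natDegree_pos (h : IsAdmissible d f) : 0 < f.natDegree := by
  rcases Nat.eq_zero_or_pos f.natDegree with h0 | h0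
  · have h1 := h.coprime
    have h2 := h.two_le
    rw [h0, Nat.coprime_zero_left] at h1
    omega
  · exact h0

theorem IsAdmissible.ne_zero (h : IsAdmissible d f) : f ≠ 0 := h.separable.ne_zero

theorem IsAdmissible.monic (h : IsAdmissible d f) : (X ^ d - C f : K[X][X]).Monic :=
  monic_X_pow_sub_C f (by have := h.two_le; omega)

/-- `y ^ d - f(x)` is an Eisenstein polynomial at any irreducible factor of `f`. -/
theorem IsAdmissible.isDomain (h : IsAdmissible d f) : IsDomain (CoordinateRing d f) := by
  have hd := h.two_le
  have hd0 : d ≠ 0 := by omega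
  obtain ⟨p, hp, hpf⟩ := WfDvdMonoid.exists_irreducible_factor (a := f)
    (fun hu => h.natDegree_pos.ne' (natDegree_eq_zero_of_isUnit hu)) h.ne_zero
  have hpp : Prime p := hp.prime
  have hirr : Irreducible (X ^ d - C f : K[X][X]) := by
    refine irreducible_of_eisenstein_criterion (P := Ideal.span {p})
      ((Ideal.span_singleton_prime hpp.ne_zero).2 hpp) ?_ ?_ ?_ ?_ h.monic.isPrimitive
    · rw [h.monic.leadingCoeff, Ideal.mem_span_singleton]
      exact hpp.not_dvd_one
    · intro m hm
      rw [degree_X_pow_sub_C (by omega)] at hm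
      have hm' : m < d := by exact_mod_cast hm
      rw [coeff_sub, coeff_X_pow, if_neg hm'.ne, zero_sub, coeff_C, Ideal.mem_span_singleton]
      split_ifs
      · exact (dvd_neg).2 hpf
      · simp
    · rw [degree_X_pow_sub_C (by omega)]
      exact_mod_cast (by omega : 0 < d)
    · rw [coeff_sub, coeff_X_pow, if_neg hd0.symm, zero_sub, coeff_C_zero,
        Ideal.span_singleton_pow, Ideal.mem_span_singleton, dvd_neg]
      intro hdvd
      exact hp.not_isUnit (h.separable.squarefree p (by rwa [← pow_two]))
  exact AdjoinRoot.isDomain_of_prime hirr.prime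

theorem aeval_of_X (p : K[X]) :
    aeval (AdjoinRoot.of (X ^ d - C f) X) p = AdjoinRoot.of (X ^ d - C f) p := by
  have h1 : (AdjoinRoot.of (X ^ d - C f)) = algebraMap K[X] (CoordinateRing d f) := rfl
  rw [h1, aeval_algebraMap_apply, aeval_X_left_apply]

/-- The coordinate ring is generated by `x` and `y`. -/
theorem mem_adjoin_coordinateRing (r : CoordinateRing d f) :
    r ∈ Algebra.adjoin K {(AdjoinRoot.of _ X : CoordinateRing d f), AdjoinRoot.root _} := by
  obtain ⟨p, rfl⟩ := AdjoinRoot.mk_surjective r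
  induction p using Polynomial.induction_on' with
  | add p q hp hq => rw [map_add]; exact add_mem hp hq
  | monomial m c =>
    rw [← C_mul_X_pow_eq_monomial, map_mul, map_pow, AdjoinRoot.mk_C, AdjoinRoot.mk_X]
    refine mul_mem ?_ (pow_mem (Algebra.subset_adjoin (by simp)) _)
    rw [← aeval_of_X c]
    exact aeval_mem_subalgebra (Algebra.subset_adjoin (by simp)) c

theorem algebraMap_of (p : K[X]) : algebraMap (CoordinateRing d f) (FunctionField d f)
    (AdjoinRoot.of _ p) = aeval (xFun d f) p := by
  rw [xFun, aeval_algebraMap_apply, aeval_of_X]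

theorem mem_adjoin_iff (h : FunctionField d f) :
    h ∈ Algebra.adjoin K {xFun d f, yFun d f} ↔
      ∃ r : CoordinateRing d f, algebraMap _ (FunctionField d f) r = h := by
  have h1 : Algebra.adjoin K {xFun d f, yFun d f} =
      (Algebra.adjoin K {(AdjoinRoot.of _ X : CoordinateRing d f), AdjoinRoot.root _}).map
        (IsScalarTower.toAlgHom K (CoordinateRing d f) (FunctionField d f)) := by
    rw [AlgHom.map_adjoin, Set.image_pair]
    rfl
  rw [h1, Subalgebra.mem_map]
  exact ⟨fun ⟨r, _, hr⟩ => ⟨r, hr⟩, fun ⟨r, hr⟩ => ⟨r, mem_adjoin_coordinateRing r, hr⟩⟩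

theorem root_pow : (AdjoinRoot.root (X ^ d - C f)) ^ d = AdjoinRoot.of (X ^ d - C f) f := by
  have := AdjoinRoot.eval₂_root (X ^ d - C f)
  rwa [eval₂_sub, eval₂_X_pow, eval₂_C, sub_eq_zero] at this

theorem yFun_pow : yFun d f ^ d = aeval (xFun d f) f := by
  rw [← algebraMap_of, yFun, ← map_pow, root_pow]

theorem xFun_mem (k : Type*) [CommSemiring k] [Algebra k (FunctionField d f)] :
    xFun d f ∈ Algebra.adjoin k {xFun d f, yFun d f} := Algebra.subset_adjoin (by simp)

theorem yFun_mem (k : Type*) [CommSemiring k] [Algebra k (FunctionField d f)] :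
    yFun d f ∈ Algebra.adjoin k {xFun d f, yFun d f} := Algebra.subset_adjoin (by simp)

theorem exists_frac [IsDomain (CoordinateRing d f)] (z : FunctionField d f) :
    ∃ p ∈ Algebra.adjoin K {xFun d f, yFun d f}, ∃ q ∈ Algebra.adjoin K {xFun d f, yFun d f},
      q ≠ 0 ∧ z * q = p := by
  obtain ⟨p, q, hq, rfl⟩ := IsFractionRing.div_surjective (A := CoordinateRing d f) z
  have hq0 : algebraMap (CoordinateRing d f) (FunctionField d f) q ≠ 0 :=
    IsFractionRing.to_map_ne_zero_of_mem_nonZeroDivisors hq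
  exact ⟨_, (mem_adjoin_iff _).2 ⟨p, rfl⟩, _, (mem_adjoin_iff _).2 ⟨q, rfl⟩, hq0,
    div_mul_cancel₀ _ hq0⟩

theorem of_injective (h : IsAdmissible d f) :
    Function.Injective (AdjoinRoot.of (X ^ d - C f : K[X][X])) := by
  refine AdjoinRoot.of.injective_of_degree_ne_zero ?_
  have := h.two_le
  rw [degree_X_pow_sub_C (by omega)]
  exact_mod_cast (by omega : d ≠ 0)

theorem aeval_xFun_injective (h : IsAdmissible d f) :
    Function.Injective (aeval (R := K) (xFun d f)) := by
  have := h.isDomain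
  intro p q hpq
  rw [← algebraMap_of, ← algebraMap_of] at hpq
  exact of_injective h (IsFractionRing.injective _ _ hpq)

section Prime

variable [IsAlgClosed K]

/-- A polynomial relation modulo a prime ideal has a root modulo that ideal. -/
theorem exists_sub_mem_of_aeval_mem {A : Type*} [CommRing A] [Algebra K A] {M : Ideal A}
    [hM : M.IsPrime] {z : A} {g : K[X]} (hg : g ≠ 0) (hz : aeval z g ∈ M) :
    ∃ c : K, g.eval c = 0 ∧ z - algebraMap K A c ∈ M := by
  have h1 := (IsAlgClosed.splits g).eq_prod_roots
  rw [h1, map_mul, aeval_C] at hz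
  have hu : IsUnit (algebraMap K A g.leadingCoeff) :=
    (IsUnit.mk0 _ (leadingCoeff_ne_zero.2 hg)).map _
  have h2 := (hM.mem_or_mem hz).resolve_left fun hc => hM.ne_top (M.eq_top_of_isUnit_mem hc hu)
  rw [map_multiset_prod, Multiset.map_map] at h2
  obtain ⟨w, hw, hwM⟩ := (hM.multiset_prod_mem_iff_exists_mem _).1 h2
  obtain ⟨c, hc, rfl⟩ := Multiset.mem_map.1 hw
  exact ⟨c, (mem_roots hg).1 hc, by simpa using hwM⟩

/-- Over an algebraically closed field, every nonzero prime ideal of the coordinate ring contains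
the ideal `(x - a, y - b)` of a point. -/
theorem exists_coords (h : IsAdmissible d f) (M : Ideal (CoordinateRing d f)) [hM : M.IsPrime]
    (hM0 : M ≠ ⊥) : ∃ a b : K, b ^ d = f.eval a ∧
      AdjoinRoot.of _ X - algebraMap K _ a ∈ M ∧ AdjoinRoot.root _ - algebraMap K _ b ∈ M := by
  have := h.isDomain
  have hd := h.two_le
  obtain ⟨r, hr, hr0⟩ := Submodule.exists_mem_ne_zero_of_ne_bot hM0
  have hint : IsIntegral K[X] r := by
    have : Module.Finite K[X] (CoordinateRing d f) := h.monic.finite_adjoinRoot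
    exact Algebra.IsIntegral.isIntegral r
  obtain ⟨g, hg, hg0⟩ := Submodule.exists_mem_ne_zero_of_ne_bot
    (Ideal.comap_ne_bot_of_integral_mem hr0 hr hint)
  have hg' : aeval (AdjoinRoot.of (X ^ d - C f) X) g ∈ M := by
    rw [aeval_of_X]
    exact hg
  obtain ⟨a, -, ha⟩ := exists_sub_mem_of_aeval_mem hg0 hg'
  have hfa : aeval (AdjoinRoot.root (X ^ d - C f)) (X ^ d - C (f.eval a) : K[X]) ∈ M := by
    obtain ⟨q, hq⟩ : (X - C a) ∣ f - C (f.eval a) := X_sub_C_dvd_sub_C_eval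
    have h2 := congrArg (aeval (AdjoinRoot.of (X ^ d - C f) X)) hq
    rw [map_sub, map_mul, map_sub, aeval_X, aeval_C, aeval_C, aeval_of_X] at h2
    rw [map_sub, map_pow, aeval_X, aeval_C, root_pow, h2]
    exact M.mul_mem_right _ ha
  obtain ⟨b, hb, hbM⟩ := exists_sub_mem_of_aeval_mem
    (X_pow_sub_C_ne_zero (by omega) (f.eval a)) hfa
  exact ⟨a, b, by simpa [sub_eq_zero] using hb, ha, hbM⟩

/-- The coordinate ring is a Dedekind domain, because the curve is smooth. -/
theorem IsAdmissible.isDedekindDomain (h : IsAdmissible d f) :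
    IsDedekindDomain (CoordinateRing d f) := by
  have := h.isDomain
  have hfin : Module.Finite K[X] (CoordinateRing d f) := h.monic.finite_adjoinRoot
  have hN : IsNoetherianRing (CoordinateRing d f) := IsNoetherianRing.of_finite K[X] _
  have : IsDedekindDomainDvr (CoordinateRing d f) :=
    { toIsNoetherian := hN
      is_dvr_at_nonzero_prime := fun M hM0 hM => by
        obtain ⟨a, b, hab, ha, hb⟩ := exists_coords h M hM0
        set x : CoordinateRing d f := AdjoinRoot.of _ X with hx
        set y : CoordinateRing d f := AdjoinRoot.root _ with hy
        have hxy : y ^ d = aeval x f := by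
          rw [hy, root_pow, hx, aeval_of_X]
        obtain ⟨s, -, e, he, u, -, v, -, hs, hS⟩ :=
          exists_localParameter h.cast_ne_zero h.separable hxy hab
        have hconst : ∀ c : K, algebraMap K (CoordinateRing d f) c ∈ M → c = 0 := fun c hc => by
          by_contra h0
          exact hM.ne_top (M.eq_top_of_isUnit_mem hc ((IsUnit.mk0 c h0).map _))
        have hsM : s ∉ M := fun hsM => he <| hconst e <| by
          have h2 : algebraMap K (CoordinateRing d f) e =
            s - (u * (x - algebraMap K _ a) + v * (y - algebraMap K _ b)) := by
            rw [hs]; ring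
          rw [h2]
          exact M.sub_mem hsM (M.add_mem (M.mul_mem_left _ ha) (M.mul_mem_left _ hb))
        have hπM : localParameter x y a b ∈ M := by
          rcases eq_or_ne b 0 with rfl | hb0
          · simpa [localParameter_zero] using hb
          · simpa [localParameter_of_ne x y a hb0] using ha
        have hnf : ¬ IsField (Localization.AtPrime M) :=
          IsLocalization.AtPrime.not_isField _ hM0 _
        refine ((IsDiscreteValuationRing.TFAE (Localization.AtPrime M) hnf).out 0 4).2 ?_
        refine ⟨algebraMap _ (Localization.AtPrime M) (localParameter x y a b), ?_⟩
        rw [← Localization.AtPrime.map_eq_maximalIdeal]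
        refine le_antisymm (Ideal.map_le_iff_le_comap.2 fun r hr => ?_) ?_
        · obtain ⟨c, r', -, hc⟩ := hS r (mem_adjoin_coordinateRing r)
          have hc0 : c = 0 := by
            refine hconst c ?_
            have h3 : s * (r - algebraMap K _ c) ∈ M := hc ▸ M.mul_mem_right _ hπM
            have h4 := M.sub_mem hr ((hM.mem_or_mem h3).resolve_left hsM)
            simpa using h4
          subst hc0
          rw [map_zero, sub_zero] at hc
          have hu : IsUnit (algebraMap _ (Localization.AtPrime M) s) :=
            IsLocalization.map_units (Localization.AtPrime M) (⟨s, hsM⟩ : M.primeCompl)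
          rw [Ideal.mem_comap]
          refine (Ideal.unit_mul_mem_iff_mem _ hu).1 ?_
          rw [← map_mul, hc, map_mul]
          exact Ideal.mul_mem_right _ _ (Ideal.mem_span_singleton_self _)
        · exact (Ideal.span_singleton_le_iff_mem _).2 (Ideal.mem_map_of_mem _ hπM) }
  infer_instance

end Prime

end Curve

/-! ### Affine points -/

section Affine

variable {K : Type*} [Field K] {d : ℕ} {f : K[X]}

theorem Point.ext_val {P Q : Point d f} (h : P.val = Q.val) : P = Q := by
  cases P; cases Q; simpa using h

/-- The point of the nonsingular model given by a nonzero prime ideal of the coordinate ring. -/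
def Point.ofPrime [IsDedekindDomain (CoordinateRing d f)]
    (v : IsDedekindDomain.HeightOneSpectrum (CoordinateRing d f)) : Point d f where
  val := v.valuation (FunctionField d f)
  surjective := v.valuation_surjective _
  trivial_on_constants := fun c hc => by
    rw [IsScalarTower.algebraMap_apply K (CoordinateRing d f) (FunctionField d f),
      v.valuation_eq_one_iff_notMem]
    exact fun h => v.isPrime.ne_top (v.asIdeal.eq_top_of_isUnit_mem h ((IsUnit.mk0 c hc).map _))

variable [IsDomain (CoordinateRing d f)]

theorem Point.HasCoords.isCentered {P : Point d f} {a b : K} (h : P.HasCoords a b) :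
    IsCentered P.val (xFun d f) (yFun d f) a b :=
  ⟨P.trivial_on_constants, h.1, h.2⟩

theorem Point.HasCoords.pow_eq {P : Point d f} {a b : K} (h : P.HasCoords a b) :
    b ^ d = f.eval a := h.isCentered.pow_eq_eval yFun_pow

theorem Point.HasCoords.not_isInfinite {P : Point d f} {a b : K} (h : P.HasCoords a b) :
    ¬ P.IsInfinite := fun hi => hi (h.isCentered.map_le_one (xFun_mem K))

theorem Point.HasCoords.eq_point {P Q : Point d f} {a b : K} (hf : IsAdmissible d f)
    (h : P.HasCoords a b) (h' : Q.HasCoords a b) : P = Q :=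
  Point.ext_val (IsCentered.eq_of_isCentered hf.cast_ne_zero hf.separable yFun_pow
    h.isCentered h'.isCentered P.surjective Q.surjective exists_frac)

theorem Point.val_localParameter {P : Point d f} {a b : K} (hf : IsAdmissible d f)
    (h : P.HasCoords a b) :
    P.val (localParameter (xFun d f) (yFun d f) a b) = WithZero.exp (-1) :=
  IsCentered.map_localParameter hf.cast_ne_zero hf.separable yFun_pow
    h.isCentered P.surjective exists_frac

theorem Point.HasCoords.coords_unique {P : Point d f} {a b a' b' : K} (h : P.HasCoords a b)
    (h' : P.HasCoords a' b') : a = a' ∧ b = b' := by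
  have aux : ∀ (z : FunctionField d f) (c c' : K), P.Vanishes (z - algebraMap K _ c) →
      P.Vanishes (z - algebraMap K _ c') → c = c' := fun z c c' hc hc' => by
    refine sub_eq_zero.1 (h.isCentered.eq_zero_of_lt ?_)
    have := P.val.map_sub_lt hc' hc
    rw [map_sub]
    convert this using 2
    ring
  exact ⟨aux _ _ _ h.1 h'.1, aux _ _ _ h.2 h'.2⟩

variable [IsAlgClosed K]

/-- The functions in the coordinate ring that vanish at a point above the affine line form a nonzero
prime ideal. -/
theorem Point.exists_hasCoords (hf : IsAdmissible d f) {P : Point d f} (hP : ¬ P.IsInfinite) :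
    ∃ a b : K, P.HasCoords a b := by
  have hx : P.val (xFun d f) ≤ 1 := not_not.1 hP
  have hc : ∀ c : K, P.val (algebraMap K _ c) ≤ 1 := fun c => by
    by_cases hc : c = 0
    · simp [hc]
    · exact (P.trivial_on_constants c hc).le
  have hd0 : d ≠ 0 := by have := hf.two_le; omega
  have hy : P.val (yFun d f) ≤ 1 := by
    rw [← pow_le_one_iff hd0, ← map_pow, yFun_pow, aeval_eq_sum_range]
    refine P.val.map_sum_le fun i _ => ?_
    rw [Algebra.smul_def, map_mul, map_pow]
    exact mul_le_one' (hc _) (pow_le_one' hx i)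
  have hR : ∀ r : CoordinateRing d f, P.val (algebraMap _ (FunctionField d f) r) ≤ 1 := fun r => by
    have hr := (mem_adjoin_iff _).2 ⟨r, rfl⟩
    generalize algebraMap (CoordinateRing d f) (FunctionField d f) r = z at hr
    induction hr using Algebra.adjoin_induction with
    | mem z hz => rcases hz with rfl | rfl <;> assumption
    | algebraMap c => exact hc c
    | add r s _ _ hr hs => exact P.val.map_add_le hr hs
    | mul r s _ _ hr hs => rw [map_mul]; exact mul_le_one' hr hs
  let M : Ideal (CoordinateRing d f) :=
    { carrier := {r | P.val (algebraMap _ (FunctionField d f) r) < 1}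
      add_mem' := fun {r s} hr hs => by
        rw [Set.mem_ofPred_eq, map_add]; exact P.val.map_add_lt hr hs
      zero_mem' := by simp
      smul_mem' := fun c r hr => by
        rw [Set.mem_ofPred_eq, smul_eq_mul, map_mul, map_mul]
        exact (mul_le_of_le_one_left' (hR c)).trans_lt hr }
  have hM : M.IsPrime := by
    refine ⟨fun h => ?_, fun {r s} hrs => ?_⟩
    · have h1 : (1 : CoordinateRing d f) ∈ M := h ▸ Submodule.mem_top
      have h2 : P.val (algebraMap (CoordinateRing d f) (FunctionField d f) 1) < 1 := h1
      simp at h2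
    · by_contra hcon
      rw [not_or] at hcon
      have h1 : P.val (algebraMap _ (FunctionField d f) r) = 1 :=
        le_antisymm (hR r) (not_lt.1 hcon.1)
      have h2 : P.val (algebraMap _ (FunctionField d f) s) = 1 :=
        le_antisymm (hR s) (not_lt.1 hcon.2)
      have h3 : P.val (algebraMap _ (FunctionField d f) (r * s)) < 1 := hrs
      rw [map_mul, map_mul, h1, h2, one_mul] at h3
      exact h3.ne rfl
  have hM0 : M ≠ ⊥ := fun h0 => by
    have h1 : ∀ r : CoordinateRing d f, r ≠ 0 →
        P.val (algebraMap _ (FunctionField d f) r) = 1 := fun r hr => by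
      refine le_antisymm (hR r) (not_lt.1 fun h => hr ?_)
      have : r ∈ M := h
      rwa [h0, Ideal.mem_bot] at this
    obtain ⟨z, hz⟩ := P.surjective (WithZero.exp 1)
    obtain ⟨p, q, hq, rfl⟩ := IsFractionRing.div_surjective (A := CoordinateRing d f) z
    have hq1 := h1 q (nonZeroDivisors.ne_zero hq)
    rw [map_div₀, hq1, div_one] at hz
    have := hz ▸ hR p
    rw [← WithZero.exp_zero, WithZero.exp_le_exp] at this
    omega
  obtain ⟨a, b, -, ha, hb⟩ := exists_coords hf M hM0
  refine ⟨a, b, ?_, ?_⟩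
  · have h1 : P.val (algebraMap _ (FunctionField d f) (AdjoinRoot.of _ X - algebraMap K _ a)) < 1 :=
      ha
    rwa [map_sub, ← IsScalarTower.algebraMap_apply] at h1
  · have h1 : P.val (algebraMap _ (FunctionField d f) (AdjoinRoot.root _ - algebraMap K _ b)) < 1 :=
      hb
    rwa [map_sub, ← IsScalarTower.algebraMap_apply] at h1

theorem exists_point (hf : IsAdmissible d f) {a b : K} (hab : b ^ d = f.eval a) :
    ∃ P : Point d f, P.HasCoords a b := by
  have := hf.isDedekindDomain
  let φ : CoordinateRing d f →+* K := AdjoinRoot.lift (evalRingHom a) b (by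
    simp [hab])
  have hx : AdjoinRoot.of _ X - algebraMap K (CoordinateRing d f) a ∈ RingHom.ker φ := by
    have h1 : algebraMap K (CoordinateRing d f) a = AdjoinRoot.of _ (C a) := rfl
    rw [RingHom.mem_ker, map_sub, h1]
    simp [φ]
  have hy : AdjoinRoot.root _ - algebraMap K (CoordinateRing d f) b ∈ RingHom.ker φ := by
    have h1 : algebraMap K (CoordinateRing d f) b = AdjoinRoot.of _ (C b) := rfl
    rw [RingHom.mem_ker, map_sub, h1]
    simp [φ]
  have hne : RingHom.ker φ ≠ ⊥ := fun h0 => by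
    have h1 : algebraMap K (CoordinateRing d f) a = AdjoinRoot.of _ (C a) := rfl
    rw [h0, Ideal.mem_bot, h1, ← map_sub] at hx
    exact X_sub_C_ne_zero a (of_injective hf (by rw [hx, map_zero]))
  let v : IsDedekindDomain.HeightOneSpectrum (CoordinateRing d f) :=
    ⟨RingHom.ker φ, RingHom.ker_isPrime φ, hne⟩
  refine ⟨Point.ofPrime v, ?_, ?_⟩
  · have : v.valuation (FunctionField d f) (algebraMap (CoordinateRing d f) _
        (AdjoinRoot.of _ X - algebraMap K (CoordinateRing d f) a)) < 1 :=
      (v.valuation_lt_one_iff_mem _).2 hx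
    rwa [map_sub, ← IsScalarTower.algebraMap_apply] at this
  · have : v.valuation (FunctionField d f) (algebraMap (CoordinateRing d f) _
        (AdjoinRoot.root _ - algebraMap K (CoordinateRing d f) b)) < 1 :=
      (v.valuation_lt_one_iff_mem _).2 hy
    rwa [map_sub, ← IsScalarTower.algebraMap_apply] at this

/-- A rational function without poles on the affine curve is a polynomial in `x` and `y`. -/
theorem mem_range_of_isRegular (hf : IsAdmissible d f) {g : FunctionField d f}
    (hg : ∀ P : Point d f, ¬ P.IsInfinite → P.IsRegular g) :
    ∃ r : CoordinateRing d f, algebraMap _ (FunctionField d f) r = g := by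
  have := hf.isDedekindDomain
  refine IsDedekindDomain.HeightOneSpectrum.mem_integers_of_valuation_le_one _ g fun v => ?_
  refine hg (Point.ofPrime v) fun hi => hi ?_
  exact v.valuation_le_one _

end Affine

/-! ### The infinite point -/

section Infinite

/-- The order of the pole at infinity of the polynomial `p(x, y)` of degree less than `d` in `y`,
where `x` and `y` have poles of order `d` and `n`: the weighted degree of `p`. -/
def poleOrder {K : Type*} [Field K] (n d : ℕ) (p : K[X][X]) : ℕ :=
  p.support.sup fun i => n * i + d * (p.coeff i).natDegree

/-- A valuation some power of which takes its values in the powers of an element `γ > 1` can be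
replaced by an integer-valued one. -/
theorem exists_int_valuation {L Γ : Type*} [Field L] [LinearOrderedCommGroupWithZero Γ]
    (w : Valuation L Γ) {γ : Γ} (hγ : 1 < γ) {d : ℕ}
    (H : ∀ z : L, z ≠ 0 → ∃ m : ℤ, w z ^ d = γ ^ m) :
    ∃ v : Valuation L ℤᵐ⁰, ∀ z : L, z ≠ 0 → ∀ m : ℤ, w z ^ d = γ ^ m → v z = WithZero.exp m := by
  classical
  choose! e he using H
  have inj : ∀ {m l : ℤ}, γ ^ m = γ ^ l → m = l := fun {m l} h =>
    (zpow_right_strictMono₀ hγ).injective h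
  have le : ∀ {m l : ℤ}, γ ^ m ≤ γ ^ l → m ≤ l := fun {m l} h =>
    (zpow_right_strictMono₀ hγ).le_iff_le.1 h
  have hγ0 : γ ≠ 0 := (zero_lt_one.trans hγ).ne'
  refine ⟨⟨⟨⟨fun z => if z = 0 then 0 else WithZero.exp (e z), by simp⟩, ?_, ?_⟩, ?_⟩, ?_⟩
  · simp only [one_ne_zero, if_false]
    rw [← WithZero.exp_zero, WithZero.exp_inj]
    refine inj ?_
    rw [← he 1 one_ne_zero]; simp
  · intro z z'
    by_cases hz : z = 0
    · simp [hz]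
    by_cases hz' : z' = 0
    · simp [hz']
    simp only [mul_eq_zero, hz, hz', or_self, if_false]
    rw [← WithZero.exp_add, WithZero.exp_inj]
    refine inj ?_
    rw [zpow_add₀ hγ0, ← he _ hz, ← he _ hz', ← he _ (mul_ne_zero hz hz'), map_mul, mul_pow]
  · intro z z'
    show (if z + z' = 0 then 0 else WithZero.exp (e (z + z'))) ≤
      max (if z = 0 then 0 else WithZero.exp (e z)) (if z' = 0 then 0 else WithZero.exp (e z'))
    by_cases hz : z = 0
    · simp [hz]
    by_cases hz' : z' = 0
    · simp [hz']
    by_cases hzz : z + z' = 0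
    · simp [hzz]
    simp only [hz, hz', hzz, if_false]
    rw [le_max_iff, WithZero.exp_le_exp, WithZero.exp_le_exp]
    rcases le_max_iff.1 (w.map_add z z') with h | h
    · left; refine le ?_
      rw [← he _ hz, ← he _ hzz]; exact pow_le_pow_left' h d
    · right; refine le ?_
      rw [← he _ hz', ← he _ hzz]; exact pow_le_pow_left' h d
  · intro z hz m hm
    show (if z = 0 then 0 else WithZero.exp (e z)) = _
    rw [if_neg hz, WithZero.exp_inj]
    exact inj (by rw [← he _ hz, hm])

variable {K : Type*} [Field K] {d : ℕ} {f : K[X]}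

theorem exists_rep (hf : IsAdmissible d f) (r : CoordinateRing d f) (hr : r ≠ 0) :
    ∃ p : K[X][X], p ≠ 0 ∧ p.natDegree < d ∧ AdjoinRoot.mk _ p = r := by
  obtain ⟨p, rfl⟩ := AdjoinRoot.mk_surjective r
  have hd := hf.two_le
  refine ⟨p %ₘ (X ^ d - C f), ?_, ?_, ?_⟩
  · intro h0
    exact hr (AdjoinRoot.mk_eq_zero.2 ((modByMonic_eq_zero_iff_dvd hf.monic).1 h0))
  · have h1 : (X ^ d - C f : K[X][X]).natDegree = d := natDegree_X_pow_sub_C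
    conv_rhs => rw [← h1]
    exact natDegree_modByMonic_lt _ hf.monic fun h => by rw [h, natDegree_one] at h1; omega
  · rw [AdjoinRoot.mk_eq_mk]
    rw [modByMonic_eq_sub_mul_div p (X ^ d - C f)]
    exact ⟨-(p /ₘ (X ^ d - C f)), by ring⟩

theorem algebraMap_mk (p : K[X][X]) :
    algebraMap (CoordinateRing d f) (FunctionField d f) (AdjoinRoot.mk _ p) =
      ∑ i ∈ p.support, aeval (xFun d f) (p.coeff i) * yFun d f ^ i := by
  conv_lhs => rw [p.as_sum_support_C_mul_X_pow]
  rw [map_sum, map_sum]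
  refine Finset.sum_congr rfl fun i _ => ?_
  rw [map_mul, map_mul, map_pow, map_pow, AdjoinRoot.mk_C, AdjoinRoot.mk_X, algebraMap_of]
  rfl

section General

variable {Γ : Type*} [LinearOrderedCommGroupWithZero Γ]
  (w : Valuation (FunctionField d f) Γ) [w.IsTrivialOn K]

theorem val_yFun_pow (hf : IsAdmissible d f) (hx : 1 < w (xFun d f)) :
    w (yFun d f) ^ d = w (xFun d f) ^ f.natDegree := by
  rw [← map_pow, yFun_pow,
    valuation_aeval_eq_valuation_X_pow_natDegree_of_one_lt_valuation_X _ hx hf.ne_zero]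

/-- If `x` has a pole at `w`, then `w(y) ^ d = w(x) ^ n`, and as `d` and `n` are coprime, the
monomials of a polynomial of degree less than `d` in `y` have distinct values. So the value of the
polynomial is given by its weighted degree. -/
theorem val_mk_pow (hf : IsAdmissible d f) (hx : 1 < w (xFun d f)) {p : K[X][X]} (hp : p ≠ 0)
    (hpd : p.natDegree < d) :
    w (algebraMap _ (FunctionField d f) (AdjoinRoot.mk (X ^ d - C f) p)) ^ d =
      w (xFun d f) ^ poleOrder f.natDegree d p := by
  classical
  have hd0 : d ≠ 0 := by have := hf.two_le; omega
  set E : ℕ → ℕ := fun i => f.natDegree * i + d * (p.coeff i).natDegree with hE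
  have hterm : ∀ i ∈ p.support, w (aeval (xFun d f) (p.coeff i) * yFun d f ^ i) ^ d =
      w (xFun d f) ^ E i := fun i hi => by
    rw [map_mul, valuation_aeval_eq_valuation_X_pow_natDegree_of_one_lt_valuation_X _ hx
      (mem_support_iff.1 hi), map_pow, mul_pow, ← pow_mul, ← pow_mul, mul_comm i d, pow_mul _ d i,
      val_yFun_pow w hf hx, ← pow_mul, ← pow_add]
    congr 1
    simp only [hE]
    ring
  obtain ⟨j, hj, hmax⟩ := p.support.exists_max_image E (support_nonempty.2 hp)
  have hlt : ∀ i ∈ p.support \ {j}, w (aeval (xFun d f) (p.coeff i) * yFun d f ^ i) <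
      w (aeval (xFun d f) (p.coeff j) * yFun d f ^ j) := fun i hi => by
    rw [Finset.mem_sdiff, Finset.mem_singleton] at hi
    refine lt_of_pow_lt_pow_left₀ d zero_le ?_
    rw [hterm i hi.1, hterm j hj]
    refine pow_lt_pow_right₀ hx (lt_of_le_of_ne (hmax i hi.1) fun heq => hi.2 ?_)
    have h1 : f.natDegree * i ≡ f.natDegree * j [MOD d] := by
      have h2 : E i % d = E j % d := by rw [heq]
      simpa [hE, Nat.ModEq] using h2
    have h3 : i ≡ j [MOD d] := Nat.ModEq.cancel_left_of_coprime hf.coprime.symm h1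
    exact h3.eq_of_lt_of_lt ((le_natDegree_of_mem_supp i hi.1).trans_lt hpd)
      ((le_natDegree_of_mem_supp j hj).trans_lt hpd)
  rw [algebraMap_mk, w.map_sum_eq_of_lt hj hlt, hterm j hj]
  congr 1
  exact le_antisymm (Finset.le_sup (f := E) hj) (Finset.sup_le hmax)

end General

instance (P : Point d f) : P.val.IsTrivialOn K := ⟨P.trivial_on_constants⟩

theorem Point.IsInfinite.one_lt {O : Point d f} (hO : O.IsInfinite) : 1 < O.val (xFun d f) :=
  not_le.1 hO

theorem xFun_ne_zero (hf : IsAdmissible d f) : xFun d f ≠ 0 := by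
  have := hf.isDomain
  intro h
  have := aeval_xFun_injective hf (a₁ := X) (a₂ := 0) (by simpa using h)
  exact X_ne_zero this

theorem yFun_ne_zero (hf : IsAdmissible d f) : yFun d f ≠ 0 := by
  have := hf.isDomain
  intro h
  have h1 := yFun_pow (d := d) (f := f)
  rw [h, zero_pow (by have := hf.two_le; omega)] at h1
  exact hf.ne_zero (aeval_xFun_injective hf (by rw [← h1, map_zero]))

/-- The value group of a normalized valuation with a pole of `x` is generated by
`log w(x) / d`, since `w(y) ^ d = w(x) ^ n` with `n` prime to `d`. -/
theorem Point.IsInfinite.val_xFun (hf : IsAdmissible d f) {O : Point d f} (hO : O.IsInfinite) :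
    O.val (xFun d f) = WithZero.exp (d : ℤ) := by
  have := hf.isDomain
  have hd := hf.two_le
  have hx := hO.one_lt
  have hx0 := (O.val.ne_zero_iff).2 (xFun_ne_zero hf)
  set l := WithZero.log (O.val (xFun d f)) with hl
  have hlpos : 0 < l := by
    rw [hl, WithZero.lt_log_iff_exp_lt hx0]
    exact hx
  have hlog : ∀ r : CoordinateRing d f, r ≠ 0 →
      ∃ m : ℤ, d * WithZero.log (O.val (algebraMap _ (FunctionField d f) r)) = m * l := by
    intro r hr
    obtain ⟨p, hp, hpd, rfl⟩ := exists_rep hf r hr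
    have h1 := congrArg WithZero.log (val_mk_pow O.val hf hx hp hpd)
    rw [WithZero.log_pow, WithZero.log_pow] at h1
    exact ⟨_, by simpa using h1⟩
  obtain ⟨z, hz⟩ := O.surjective (WithZero.exp 1)
  have hz0 : z ≠ 0 := by
    rintro rfl
    rw [map_zero] at hz
    exact WithZero.exp_ne_zero hz.symm
  obtain ⟨p, q, hq, rfl⟩ := IsFractionRing.div_surjective (A := CoordinateRing d f) z
  have hq0 : algebraMap (CoordinateRing d f) (FunctionField d f) q ≠ 0 :=
    IsFractionRing.to_map_ne_zero_of_mem_nonZeroDivisors hq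
  have hp0 : algebraMap (CoordinateRing d f) (FunctionField d f) p ≠ 0 :=
    fun h => hz0 (by rw [h, zero_div])
  obtain ⟨m, hm⟩ := hlog p (fun h => hp0 (by rw [h, map_zero]))
  obtain ⟨m', hm'⟩ := hlog q (nonZeroDivisors.ne_zero hq)
  have h1 : l ∣ d := by
    have h2 := congrArg WithZero.log hz
    rw [map_div₀, WithZero.log_div (O.val.ne_zero_iff.2 hp0) (O.val.ne_zero_iff.2 hq0),
      WithZero.log_exp] at h2
    exact ⟨m - m', by linear_combination hm - hm' - (d : ℤ) * h2⟩
  have h2 : (d : ℤ) ∣ l := by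
    have h3 := congrArg WithZero.log (val_yFun_pow O.val hf hx)
    rw [WithZero.log_pow, WithZero.log_pow, ← hl] at h3
    simp only [nsmul_eq_mul] at h3
    have h4 : IsCoprime (d : ℤ) (f.natDegree : ℤ) := Nat.isCoprime_iff_coprime.2 hf.coprime.symm
    exact h4.dvd_of_dvd_mul_left ⟨_, h3.symm⟩
  have h3 : l = d := Int.dvd_antisymm hlpos.le (by positivity) h1 h2
  rw [← h3, hl, WithZero.exp_log hx0]

theorem Point.IsInfinite.val_mk (hf : IsAdmissible d f) {O : Point d f} (hO : O.IsInfinite)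
    {p : K[X][X]} (hp : p ≠ 0) (hpd : p.natDegree < d) :
    O.val (algebraMap _ (FunctionField d f) (AdjoinRoot.mk (X ^ d - C f) p)) =
      WithZero.exp (poleOrder f.natDegree d p : ℤ) := by
  have hd0 : d ≠ 0 := by have := hf.two_le; omega
  have h1 := val_mk_pow O.val hf hO.one_lt hp hpd
  rw [hO.val_xFun hf, ← WithZero.exp_nsmul] at h1
  have hne : O.val (algebraMap _ (FunctionField d f) (AdjoinRoot.mk (X ^ d - C f) p)) ≠ 0 := by
    intro h0
    rw [h0, zero_pow hd0] at h1
    exact WithZero.exp_ne_zero h1.symm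
  rw [← WithZero.exp_log hne]
  congr 1
  have h2 := congrArg WithZero.log h1
  rw [WithZero.log_pow, WithZero.log_exp] at h2
  simp only [nsmul_eq_mul] at h2
  exact mul_left_cancel₀ (Nat.cast_ne_zero.2 hd0) (by rw [h2]; ring)

theorem Point.IsInfinite.eq_point (hf : IsAdmissible d f) {O O' : Point d f}
    (hO : O.IsInfinite) (hO' : O'.IsInfinite) : O = O' := by
  have := hf.isDomain
  have hR : ∀ r : CoordinateRing d f, O.val (algebraMap _ (FunctionField d f) r) =
      O'.val (algebraMap _ (FunctionField d f) r) := fun r => by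
    by_cases hr : r = 0
    · simp [hr]
    obtain ⟨p, hp, hpd, rfl⟩ := exists_rep hf r hr
    rw [hO.val_mk hf hp hpd, hO'.val_mk hf hp hpd]
  refine Point.ext_val (Valuation.ext fun z => ?_)
  obtain ⟨p, q, hq, rfl⟩ := IsFractionRing.div_surjective (A := CoordinateRing d f) z
  rw [map_div₀, map_div₀, hR, hR]

/-- There is a valuation with a pole of `x` that is trivial on the constants: `1 / x` generates a
proper ideal of `K[1 / x]`, which is dominated by a valuation ring. -/
theorem exists_valuationSubring (hf : IsAdmissible d f) [IsDomain (CoordinateRing d f)] :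
    ∃ V : ValuationSubring (FunctionField d f),
      (∀ c : K, algebraMap K _ c ∈ V) ∧ xFun d f ∉ V := by
  have hx0 := xFun_ne_zero hf
  set S := Algebra.adjoin K {(xFun d f)⁻¹} with hS
  let t : S.toSubring := ⟨(xFun d f)⁻¹, Algebra.subset_adjoin rfl⟩
  have hne : Ideal.span {t} ≠ ⊤ := by
    rw [Ne, Ideal.span_singleton_eq_top]
    intro hu
    obtain ⟨⟨s, hs⟩, hts⟩ := hu.exists_right_inv
    have hts' : (xFun d f)⁻¹ * s = 1 := congrArg Subtype.val hts
    have hsx : s = xFun d f := by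
      field_simp at hts'
      exact hts'
    have hs' : s ∈ Algebra.adjoin K {(xFun d f)⁻¹} := hs
    rw [Algebra.adjoin_singleton_eq_range_aeval] at hs'
    obtain ⟨p, hp⟩ := hs'
    -- `x = p(1 / x)` makes `1 / x`, hence `x`, algebraic over `K`.
    have h1 : aeval (xFun d f)⁻¹ (X * p - 1 : K[X]) = 0 := by
      have hp' : aeval (xFun d f)⁻¹ p = s := hp
      rw [map_sub, map_mul, aeval_X, map_one, hp', hts', sub_self]
    have h2 : (X * p - 1 : K[X]) ≠ 0 := fun h => by
      have := congrArg (coeff · 0) h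
      simp at this
    have h3 : IsAlgebraic K (xFun d f)⁻¹ := ⟨_, h2, h1⟩
    have h4 : IsAlgebraic K (xFun d f) := by simpa using h3.inv
    obtain ⟨q, hq0, hq⟩ := h4
    exact hq0 (aeval_xFun_injective hf (by rw [hq, map_zero]))
  obtain ⟨V, hSV, hV⟩ := Ideal.image_subset_nonunits_valuationSubring _ hne
  refine ⟨V, fun c => hSV (S.algebraMap_mem c), fun hxV => ?_⟩
  have h1 : (xFun d f)⁻¹ ∈ V.nonunits := hV ⟨t, Ideal.mem_span_singleton_self t, rfl⟩
  rw [V.inv_mem_nonunits_iff] at h1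
  exact h1.elim hx0 fun h => h hxV

/-- The values of a valuation with a pole of `x` are determined by weighted degrees, so that it can
be normalized. -/
theorem exists_isInfinite (hf : IsAdmissible d f) : ∃ O : Point d f, O.IsInfinite := by
  have := hf.isDomain
  have hd := hf.two_le
  obtain ⟨V, hV, hxV⟩ := exists_valuationSubring hf
  set w := V.valuation with hw
  have hx : 1 < w (xFun d f) := by
    rw [← not_le, hw, V.valuation_le_one_iff]
    exact hxV
  have hc : ∀ c : K, c ≠ 0 → w (algebraMap K _ c) = 1 := fun c hc => by
    refine le_antisymm ((V.valuation_le_one_iff _).2 (hV c)) ?_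
    have h1 := (V.valuation_le_one_iff _).2 (hV c⁻¹)
    rw [map_inv₀, map_inv₀] at h1
    have h2 : V.valuation (algebraMap K (FunctionField d f) c) ≠ 0 :=
      V.valuation.ne_zero_iff.2 (by simpa using hc)
    exact (inv_le_one₀ (zero_lt_iff.2 h2)).1 h1
  have : w.IsTrivialOn K := ⟨hc⟩
  have hγ0 : w (xFun d f) ≠ 0 := (zero_lt_one.trans hx).ne'
  have hR : ∀ r : CoordinateRing d f, r ≠ 0 →
      ∃ m : ℤ, w (algebraMap _ (FunctionField d f) r) ^ d = w (xFun d f) ^ m := fun r hr => by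
    obtain ⟨p, hp, hpd, rfl⟩ := exists_rep hf r hr
    exact ⟨poleOrder f.natDegree d p, by rw [zpow_natCast]; exact val_mk_pow w hf hx hp hpd⟩
  obtain ⟨v, hv⟩ := exists_int_valuation w hx fun z hz => by
    obtain ⟨p, q, hq, rfl⟩ := IsFractionRing.div_surjective (A := CoordinateRing d f) z
    obtain ⟨m, hm⟩ := hR p (fun h => hz (by rw [h, map_zero, zero_div]))
    obtain ⟨m', hm'⟩ := hR q (nonZeroDivisors.ne_zero hq)
    exact ⟨m - m', by rw [map_div₀, div_pow, hm, hm', zpow_sub₀ hγ0]⟩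
  have hvx : v (xFun d f) = WithZero.exp (d : ℤ) :=
    hv _ (xFun_ne_zero hf) d (by rw [zpow_natCast])
  have hvy : v (yFun d f) = WithZero.exp (f.natDegree : ℤ) :=
    hv _ (yFun_ne_zero hf) f.natDegree (by rw [zpow_natCast]; exact val_yFun_pow w hf hx)
  refine ⟨⟨v, fun γ => ?_, fun c hc0 => ?_⟩, ?_⟩
  · by_cases hγ : γ = 0
    · exact ⟨0, by rw [map_zero, hγ]⟩
    obtain ⟨u, s, hus⟩ : IsCoprime (f.natDegree : ℤ) (d : ℤ) :=
      Nat.isCoprime_iff_coprime.2 hf.coprime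
    set k := WithZero.log γ with hk
    refine ⟨yFun d f ^ (k * u) * xFun d f ^ (k * s), ?_⟩
    rw [map_mul, map_zpow₀, map_zpow₀, hvx, hvy, ← WithZero.exp_zsmul, ← WithZero.exp_zsmul,
      ← WithZero.exp_add, ← WithZero.exp_log hγ, ← hk]
    congr 1
    simp only [smul_eq_mul]
    linear_combination k * hus
  · rw [← WithZero.exp_zero]
    exact hv _ (by simpa using hc0) 0 (by rw [hc c hc0, one_pow, zpow_zero])
  · show ¬ v (xFun d f) ≤ 1
    rw [hvx, ← WithZero.exp_zero, WithZero.exp_le_exp]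
    omega

end Infinite

/-! ### Values of functions at points -/

section Values

variable {K : Type*} [Field K] {d : ℕ} {f : K[X]} [IsDomain (CoordinateRing d f)]

theorem Point.HasCoords.ne_infinite {P O : Point d f} {a b : K} (hP : P.HasCoords a b)
    (hO : O.IsInfinite) : P ≠ O := fun h => hP.not_isInfinite (h ▸ hO)

theorem Point.HasCoords.val_le_one {P : Point d f} {a b : K} (h : P.HasCoords a b)
    {r : FunctionField d f} (hr : r ∈ Algebra.adjoin K {xFun d f, yFun d f}) : P.val r ≤ 1 :=
  h.isCentered.map_le_one hr

theorem Point.HasCoords.val_aeval_sub_lt {P : Point d f} {a b : K} (h : P.HasCoords a b)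
    (q : K[X]) : P.val (aeval (xFun d f) q - algebraMap K _ (q.eval a)) < 1 := by
  obtain ⟨q', hq'⟩ : (X - C a) ∣ q - C (q.eval a) := X_sub_C_dvd_sub_C_eval
  have h1 := congrArg (aeval (xFun d f)) hq'
  simp only [map_sub, map_mul, aeval_X, aeval_C] at h1
  rw [h1, map_mul]
  exact (mul_le_of_le_one_right' (h.val_le_one (aeval_mem_subalgebra (xFun_mem K) q'))).trans_lt h.1

theorem Point.HasCoords.val_aeval_eq_one {P : Point d f} {a b : K} (h : P.HasCoords a b)
    {q : K[X]} (hq : q.eval a ≠ 0) : P.val (aeval (xFun d f) q) = 1 :=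
  h.isCentered.map_eq_one hq (h.val_aeval_sub_lt q)

theorem Point.HasCoords.val_aeval_lt_one {P : Point d f} {a b : K} (h : P.HasCoords a b)
    {q : K[X]} (hq : q.eval a = 0) : P.val (aeval (xFun d f) q) < 1 := by
  simpa [hq] using h.val_aeval_sub_lt q

theorem Point.HasCoords.val_aeval_lt_one_iff {P : Point d f} {a b : K} (h : P.HasCoords a b)
    {q : K[X]} : P.val (aeval (xFun d f) q) < 1 ↔ q.eval a = 0 :=
  ⟨fun hlt => by_contra fun hq => hlt.ne (h.val_aeval_eq_one hq), h.val_aeval_lt_one⟩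

/-- Away from the zeros of `y`, the function `x - a` is a local parameter. -/
theorem Point.HasCoords.val_aeval {P : Point d f} {a b : K} (hf : IsAdmissible d f)
    (h : P.HasCoords a b) (hb : b ≠ 0) {q : K[X]} (hq : q ≠ 0) :
    P.val (aeval (xFun d f) q) = WithZero.exp (-(q.rootMultiplicity a : ℤ)) := by
  obtain ⟨q', hq', hdvd⟩ := exists_eq_pow_rootMultiplicity_mul_and_not_dvd q hq a
  have hπ := Point.val_localParameter hf h
  rw [localParameter_of_ne _ _ _ hb] at hπ
  have h1 := congrArg (fun q => P.val (aeval (xFun d f) q)) hq'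
  simp only [map_mul, map_pow, map_sub, aeval_X, aeval_C] at h1
  rw [h1, hπ, h.val_aeval_eq_one (fun h0 => hdvd (dvd_iff_isRoot.2 h0)), mul_one,
    ← WithZero.exp_nsmul]
  congr 1
  simp

omit [IsDomain (CoordinateRing d f)] in
theorem Point.IsInfinite.val_yFun (hf : IsAdmissible d f) {O : Point d f} (hO : O.IsInfinite) :
    O.val (yFun d f) = WithZero.exp (f.natDegree : ℤ) := by
  have hd0 : d ≠ 0 := by have := hf.two_le; omega
  have := hf.isDomain
  have hne := O.val.ne_zero_iff.2 (yFun_ne_zero hf)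
  have h1 := congrArg WithZero.log (val_yFun_pow O.val hf hO.one_lt)
  rw [hO.val_xFun hf, WithZero.log_pow, WithZero.log_pow, WithZero.log_exp] at h1
  simp only [nsmul_eq_mul] at h1
  rw [← WithZero.exp_log hne]
  congr 1
  exact mul_left_cancel₀ (Nat.cast_ne_zero.2 hd0) (by rw [h1]; ring)

omit [IsDomain (CoordinateRing d f)] in
theorem Point.IsInfinite.val_aeval (hf : IsAdmissible d f) {O : Point d f} (hO : O.IsInfinite)
    {q : K[X]} (hq : q ≠ 0) :
    O.val (aeval (xFun d f) q) = WithZero.exp ((d * q.natDegree : ℕ) : ℤ) := by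
  rw [valuation_aeval_eq_valuation_X_pow_natDegree_of_one_lt_valuation_X _ hO.one_lt hq,
    hO.val_xFun hf, ← WithZero.exp_nsmul]
  congr 1
  simp [mul_comm]

end Values

/-! ### Torsion in the jacobian -/

section Torsion

variable {K : Type*} [Field K] {d : ℕ} {f : K[X]}

theorem nsmul_toJacobian_eq_zero_iff (O P : Point d f) (k : ℕ) :
    k • toJacobian O P = 0 ↔ ∃ g : (FunctionField d f)ˣ, ∀ Q : Point d f,
      (k • (Finsupp.single P 1 - Finsupp.single O 1) : Divisor d f) Q = Q.ord g := by
  rw [toJacobian, ← QuotientAddGroup.mk_nsmul, QuotientAddGroup.eq_zero_iff,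
    AddSubgroup.mem_addSubgroupOf]
  rfl

variable [IsDomain (CoordinateRing d f)]

/-- The criterion for `k (P) - k (O)` to be principal, in terms of valuations. -/
theorem nsmul_toJacobian_eq_zero_iff_val {O P : Point d f} (hPO : P ≠ O) (k : ℕ) :
    k • toJacobian O P = 0 ↔ ∃ g : FunctionField d f, P.val g = WithZero.exp (-(k : ℤ)) ∧
      O.val g = WithZero.exp (k : ℤ) ∧ ∀ Q : Point d f, Q ≠ P → Q ≠ O → Q.val g = 1 := by
  classical
  rw [nsmul_toJacobian_eq_zero_iff]
  have hval : ∀ Q : Point d f, (k • (Finsupp.single P 1 - Finsupp.single O 1) : Divisor d f) Q =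
      if Q = P then (k : ℤ) else if Q = O then -(k : ℤ) else 0 := fun Q => by
    rw [Finsupp.smul_apply, Finsupp.sub_apply, Finsupp.single_apply, Finsupp.single_apply]
    by_cases h1 : Q = P
    · subst h1; simp [hPO.symm]
    · by_cases h2 : Q = O
      · subst h2; simp [h1, Ne.symm h1]
      · simp [h1, h2, Ne.symm h1, Ne.symm h2]
  constructor
  · rintro ⟨g, hg⟩
    have hg' : ∀ Q : Point d f, Q.val g =
        WithZero.exp (-(if Q = P then (k : ℤ) else if Q = O then -(k : ℤ) else 0)) := fun Q => by
      rw [← hval, hg, Point.ord, neg_neg, WithZero.exp_log (Q.val.ne_zero_iff.2 g.ne_zero)]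
    refine ⟨g, ?_, ?_, fun Q h1 h2 => ?_⟩
    · rw [hg', if_pos rfl]
    · rw [hg', if_neg hPO.symm, if_pos rfl, neg_neg]
    · rw [hg', if_neg h1, if_neg h2, neg_zero, WithZero.exp_zero]
  · rintro ⟨g, hP, hO, hQ⟩
    have hg0 : g ≠ 0 := by
      rintro rfl
      rw [map_zero] at hP
      exact WithZero.exp_ne_zero hP.symm
    refine ⟨Units.mk0 g hg0, fun Q => ?_⟩
    rw [hval, Point.ord, Units.val_mk0]
    by_cases h1 : Q = P
    · subst h1; rw [hP, WithZero.log_exp]; simp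
    · by_cases h2 : Q = O
      · subst h2; rw [hO, WithZero.log_exp]; simp [h1]
      · rw [hQ Q h1 h2, WithZero.log_one]; simp [h1, h2]

omit [IsDomain (CoordinateRing d f)] in
theorem Point.hasOrder_iff (hf : IsAdmissible d f) {O : Point d f} (hO : O.IsInfinite)
    (P : Point d f) (m : ℕ) : P.HasOrder m ↔ addOrderOf (toJacobian O P) = m := by
  constructor
  · rintro ⟨O', hO', h⟩
    rwa [(hO' O).1 hO]
  · intro h
    exact ⟨O, fun Q => ⟨fun hQ => hQ.eq_point hf hO, fun hQ => hQ ▸ hO⟩, h⟩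

omit [IsDomain (CoordinateRing d f)] in
theorem toJacobian_self (O : Point d f) : toJacobian O O = 0 := by
  have := (nsmul_toJacobian_eq_zero_iff O O 1).2 ⟨1, fun Q => by simp [Point.ord]⟩
  simpa using this

variable [IsAlgClosed K]

/-- A function whose divisor is `k (P) - k (O)` is a polynomial in `x` and `y` of weighted
degree `k`. -/
theorem exists_poly_of_nsmul_eq_zero (hf : IsAdmissible d f) {O P : Point d f}
    (hO : O.IsInfinite) (hPO : P ≠ O) {k : ℕ} (hk : k • toJacobian O P = 0) :
    ∃ p : K[X][X], p ≠ 0 ∧ p.natDegree < d ∧ poleOrder f.natDegree d p = k ∧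
      P.val (algebraMap (CoordinateRing d f) _ (AdjoinRoot.mk _ p)) = WithZero.exp (-(k : ℤ)) ∧
      ∀ Q : Point d f, Q ≠ P → Q ≠ O →
        Q.val (algebraMap (CoordinateRing d f) _ (AdjoinRoot.mk _ p)) = 1 := by
  obtain ⟨g, hgP, hgO, hgQ⟩ := (nsmul_toJacobian_eq_zero_iff_val hPO k).1 hk
  obtain ⟨r, rfl⟩ := mem_range_of_isRegular hf (g := g) fun Q hQ => by
    have hQO : Q ≠ O := fun h => hQ (h ▸ hO)
    show Q.val g ≤ 1
    by_cases hQP : Q = P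
    · rw [hQP, hgP, ← WithZero.exp_zero, WithZero.exp_le_exp]; omega
    · rw [hgQ Q hQP hQO]
  have hr : r ≠ 0 := by
    rintro rfl
    rw [map_zero, map_zero] at hgP
    exact WithZero.exp_ne_zero hgP.symm
  obtain ⟨p, hp, hpd, rfl⟩ := exists_rep hf r hr
  refine ⟨p, hp, hpd, ?_, hgP, hgQ⟩
  rw [hO.val_mk hf hp hpd, WithZero.exp_inj] at hgO
  exact_mod_cast hgO

/-- If the only zero of a nonconstant polynomial in `x` is the point `(a, b)`, then `b = 0`:
otherwise the points `(a, ζ b)` with `ζ ^ d = 1` are further zeros. -/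
theorem eq_zero_of_val_aeval (hf : IsAdmissible d f) {O P : Point d f} (hO : O.IsInfinite)
    {a b : K} (hP : P.HasCoords a b) {q : K[X]} (hq : q.natDegree ≠ 0)
    (hQ : ∀ Q : Point d f, Q ≠ P → Q ≠ O → Q.val (aeval (xFun d f) q) = 1) : b = 0 := by
  have hd := hf.two_le
  have hzero : ∀ α β : K, q.eval α = 0 → β ^ d = f.eval α → α = a ∧ β = b := fun α β hα hβ => by
    obtain ⟨Q, hQc⟩ := exists_point hf hβ
    have hQP : Q = P := by
      by_contra hne
      exact (hQc.val_aeval_lt_one hα).ne (hQ Q hne fun h => hQc.not_isInfinite (h ▸ hO))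
    subst hQP
    exact hQc.coords_unique hP
  obtain ⟨α, hα⟩ := IsAlgClosed.exists_root q (fun h => hq (natDegree_eq_of_degree_eq_some h))
  obtain ⟨β, hβ⟩ := IsAlgClosed.exists_pow_nat_eq (f.eval α) (by omega : 0 < d)
  obtain ⟨rfl, rfl⟩ := hzero α β hα hβ
  have : NeZero (d : K) := ⟨hf.cast_ne_zero⟩
  obtain ⟨ζ, hζ⟩ := HasEnoughRootsOfUnity.exists_primitiveRoot K d
  have h1 := (hzero α (ζ * β) hα (by rw [mul_pow, hζ.pow_eq_one, one_mul, hβ])).2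
  by_contra hb
  exact hζ.ne_one (by omega) (mul_right_cancel₀ hb (by rw [h1, one_mul]))

omit [IsDomain (CoordinateRing d f)] [IsAlgClosed K] in
theorem le_poleOrder {n : ℕ} {p : K[X][X]} {i : ℕ} (hi : p.coeff i ≠ 0) :
    n * i + d * (p.coeff i).natDegree ≤ poleOrder n d p :=
  Finset.le_sup (f := fun i => n * i + d * (p.coeff i).natDegree) (mem_support_iff.2 hi)

omit [IsDomain (CoordinateRing d f)] [IsAlgClosed K] in
/-- A function with a pole of order less than `n` at infinity is a polynomial in `x`. -/
theorem eq_C_of_poleOrder_lt {n : ℕ} {p : K[X][X]} (h : poleOrder n d p < n) :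
    p = C (p.coeff 0) := by
  refine eq_C_of_natDegree_eq_zero ?_
  by_contra h0
  have h1 := le_poleOrder (d := d) (n := n) (p := p) (i := p.natDegree)
    (leadingCoeff_ne_zero.2 (fun hp => h0 (by rw [hp, natDegree_zero])))
  have h2 : n * 1 ≤ n * p.natDegree := Nat.mul_le_mul_left n (Nat.pos_of_ne_zero h0)
  omega

omit [IsDomain (CoordinateRing d f)] [IsAlgClosed K] in
theorem poleOrder_C {n : ℕ} {q : K[X]} : poleOrder n d (C q) = d * q.natDegree := by
  by_cases hq : q = 0
  · simp [hq, poleOrder]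
  · rw [poleOrder, support_C hq]
    simp

/-- A point of order less than `n` lies on the line `y = 0`, and its order is a multiple
of `d`. -/
theorem eq_zero_of_nsmul_eq_zero (hf : IsAdmissible d f) {O P : Point d f} (hO : O.IsInfinite)
    {a b : K} (hP : P.HasCoords a b) {k : ℕ} (hk0 : 0 < k) (hk : k < f.natDegree)
    (hk' : k • toJacobian O P = 0) : b = 0 ∧ d ∣ k := by
  have hPO := hP.ne_infinite hO
  obtain ⟨p, hp, hpd, hpk, hpP, hpQ⟩ := exists_poly_of_nsmul_eq_zero hf hO hPO hk'
  have hpC := eq_C_of_poleOrder_lt (d := d) (hpk.trans_lt hk)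
  rw [hpC, poleOrder_C] at hpk
  rw [hpC, AdjoinRoot.mk_C] at hpQ
  refine ⟨eq_zero_of_val_aeval hf hO hP (q := p.coeff 0) (fun h => ?_) fun Q h1 h2 => ?_,
    ⟨_, hpk.symm⟩⟩
  · rw [h, mul_zero] at hpk; omega
  · rw [← algebraMap_of]; exact hpQ Q h1 h2

/-- The points on the line `y = 0` have order `d`: the divisor of `x - a` is `d (P) - d (O)`. -/
theorem Point.HasCoords.hasOrder_of_eq_zero (hf : IsAdmissible d f) (hdn : d ≤ f.natDegree)
    {P : Point d f} {a : K} (hP : P.HasCoords a 0) : P.HasOrder d := by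
  have hd := hf.two_le
  obtain ⟨O, hO⟩ := exists_isInfinite hf
  have hPO : P ≠ O := hP.ne_infinite hO
  rw [Point.hasOrder_iff hf hO]
  have hfa : f.eval a = 0 := by rw [← hP.pow_eq, zero_pow (by omega)]
  have hXa : aeval (xFun d f) (X - C a) = xFun d f - algebraMap K _ a := by simp
  have hdz : d • toJacobian O P = 0 := by
    rw [nsmul_toJacobian_eq_zero_iff_val hPO]
    refine ⟨xFun d f - algebraMap K _ a, ?_, ?_, fun Q hQP hQO => ?_⟩
    · obtain ⟨q, hq⟩ := dvd_iff_isRoot.2 hfa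
      have hqa : q.eval a ≠ 0 := by
        have h1 := hf.separable.eval₂_derivative_ne_zero (RingHom.id K) (x := a)
          (by simpa using hfa)
        have h2 := congrArg (fun p => (derivative p).eval a) hq
        simp only [derivative_mul, derivative_sub, derivative_X, derivative_C, sub_zero, one_mul,
          eval_add, eval_mul, eval_sub, eval_X, eval_C, sub_self, zero_mul, add_zero] at h2
        rw [← h2]
        simpa using h1
      have h1 := congrArg (fun p => P.val (aeval (xFun d f) p)) hq
      have hπ := Point.val_localParameter hf hP
      rw [localParameter_zero] at hπ
      simp only [map_mul] at h1
      rw [← yFun_pow, map_pow, hπ, hP.val_aeval_eq_one hqa, mul_one, hXa,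
        ← WithZero.exp_nsmul] at h1
      rw [← h1]
      congr 1
      simp
    · rw [← hXa, hO.val_aeval hf (X_sub_C_ne_zero a), natDegree_X_sub_C, mul_one]
    · obtain ⟨α, β, hQ⟩ := Point.exists_hasCoords hf (fun h => hQO (h.eq_point hf hO))
      rw [← hXa]
      refine hQ.val_aeval_eq_one fun h0 => hQP ?_
      obtain rfl : α = a := by simpa [sub_eq_zero] using h0
      have hβ := hQ.pow_eq
      rw [hfa] at hβ
      obtain rfl := eq_zero_of_pow_eq_zero hβ
      exact hQ.eq_point hf hP
  have hpos : 0 < addOrderOf (toJacobian O P) :=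
    addOrderOf_pos_iff.2 (isOfFinAddOrder_iff_nsmul_eq_zero.2 ⟨d, by omega, hdz⟩)
  refine le_antisymm (addOrderOf_le_of_nsmul_eq_zero (by omega) hdz) (not_lt.1 fun hlt => ?_)
  have h1 := (eq_zero_of_nsmul_eq_zero hf hO hP hpos (hlt.trans_le hdn)
    (addOrderOf_nsmul_eq_zero _)).2
  exact absurd (Nat.le_of_dvd hpos h1) (by omega)

/-- If `f = A ^ d + c (x - a) ^ (d ℓ)` with `ℓ = deg A`, then the divisor of `y - A(x)` is
`d ℓ (P) - d ℓ (O)`, where `P = (a, A(a))`. -/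
theorem nsmul_eq_zero_of_eq_pow_add (hf : IsAdmissible d f) {O P : Point d f}
    (hO : O.IsInfinite) {a : K} {A : K[X]} (hP : P.HasCoords a (A.eval a)) (hA : A.eval a ≠ 0)
    {c : K} (hc : c ≠ 0) (hfA : f = A ^ d + C c * (X - C a) ^ (d * A.natDegree))
    (hn : f.natDegree < d * A.natDegree) : (d * A.natDegree) • toJacobian O P = 0 := by
  have hPO := hP.ne_infinite hO
  have hd := hf.two_le
  set x := xFun d f with hx
  set y := yFun d f with hy
  have hAx : aeval x A ∈ Algebra.adjoin K {x, y} := aeval_mem_subalgebra (xFun_mem K) A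
  have hA0 : A ≠ 0 := fun h => hA (by rw [h, eval_zero])
  -- `y ^ d - A ^ d = (y - A) s`, where `s` does not vanish at `P`.
  set s := ∑ i ∈ Finset.range d, y ^ i * aeval x A ^ (d - 1 - i) with hs
  have hsmem : s ∈ Algebra.adjoin K {x, y} :=
    sum_mem fun i _ => mul_mem (pow_mem (yFun_mem K) _) (pow_mem hAx _)
  have hfac : s * (y - aeval x A) =
      algebraMap K _ c * (x - algebraMap K _ a) ^ (d * A.natDegree) := by
    rw [hs, (Commute.all y (aeval x A)).geom_sum₂_mul, hy, yFun_pow, ← hx]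
    have h1 := congrArg (aeval (R := K) x) hfA
    simp only [map_add, map_mul, map_pow, map_sub, aeval_X, aeval_C] at h1
    rw [h1, add_sub_cancel_left]
  rw [nsmul_toJacobian_eq_zero_iff_val hPO]
  refine ⟨y - aeval x A, ?_, ?_, fun Q hQP hQO => ?_⟩
  · have hs1 : P.val s = 1 := by
      have hne : (d : K) * A.eval a ^ (d - 1) ≠ 0 :=
        mul_ne_zero hf.cast_ne_zero (pow_ne_zero _ hA)
      -- The value of `s` at `P` is the derivative of `T ^ d` at `T = A(a)`.
      have hyA : P.val (y - aeval x A) < 1 := by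
        have := P.val.map_sub_lt hP.2 (hP.val_aeval_sub_lt A)
        convert this using 2
        simp only [hx, hy]
        ring
      refine hP.isCentered.map_eq_one hne ?_
      have h1 : P.val (s - (d : FunctionField d f) * aeval x A ^ (d - 1)) < 1 := by
        have h2 : (d : FunctionField d f) * aeval x A ^ (d - 1) =
            ∑ i ∈ Finset.range d, aeval x A ^ i * aeval x A ^ (d - 1 - i) := by
          rw [Finset.sum_congr rfl (g := fun _ => aeval x A ^ (d - 1))]
          · simp
          · intro i hi
            rw [Finset.mem_range] at hi
            rw [← pow_add]; congr 1; omega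
        rw [h2, hs, ← Finset.sum_sub_distrib]
        refine P.val.map_sum_lt one_ne_zero fun i _ => ?_
        rw [← sub_mul]
        rw [← (Commute.all y (aeval x A)).geom_sum₂_mul, map_mul, map_mul]
        refine (mul_le_of_le_one_right' (hP.val_le_one (pow_mem hAx _))).trans_lt ?_
        exact (mul_le_of_le_one_left' (hP.val_le_one (sum_mem fun i _ =>
          mul_mem (pow_mem (yFun_mem K) _) (pow_mem hAx _)))).trans_lt hyA
      have h3 := hP.val_aeval_sub_lt ((d : K[X]) * A ^ (d - 1))
      simp only [map_mul, map_pow, eval_mul, eval_natCast, eval_pow, map_natCast] at h3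
      have h4 := P.val.map_add_lt h1 h3
      rw [map_mul, map_pow, map_natCast]
      convert h4 using 2
      simp only [hx]
      ring
    have h1 := congrArg P.val hfac
    have hπ := Point.val_localParameter hf hP
    rw [localParameter_of_ne _ _ _ hA] at hπ
    rw [map_mul, map_mul, hs1, one_mul, P.trivial_on_constants c hc, one_mul, map_pow, hπ,
      ← WithZero.exp_nsmul] at h1
    rw [h1]
    congr 1
    simp
  · have h1 := hO.val_aeval hf hA0
    have h2 := hO.val_yFun hf
    rw [O.val.map_sub_eq_of_lt_right (by rw [h1, h2, WithZero.exp_lt_exp]; exact_mod_cast hn), h1]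
  · obtain ⟨α, β, hQ⟩ := Point.exists_hasCoords hf (fun h => hQO (h.eq_point hf hO))
    refine le_antisymm (hQ.val_le_one (sub_mem (yFun_mem K) hAx)) (not_lt.1 fun hlt => hQP ?_)
    have h1 := congrArg Q.val hfac
    have h2 : Q.val (s * (y - aeval x A)) < 1 := by
      rw [map_mul]; exact (mul_le_of_le_one_left' (hQ.val_le_one hsmem)).trans_lt hlt
    rw [h1] at h2
    have h3 : (C c * (X - C a) ^ (d * A.natDegree)).eval α = 0 := by
      refine hQ.val_aeval_lt_one_iff.1 ?_
      simpa using h2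
    have h4 : α = a := by
      rw [eval_mul, eval_C, eval_pow] at h3
      have := eq_zero_of_pow_eq_zero ((mul_eq_zero.1 h3).resolve_left hc)
      simpa [sub_eq_zero] using this
    subst h4
    have h5 : β = A.eval α := by
      refine sub_eq_zero.1 (hQ.isCentered.eq_zero_of_lt ?_)
      have := Q.val.map_sub_lt (Q.val.map_add_lt hlt (hQ.val_aeval_sub_lt A)) hQ.2
      rw [map_sub]
      convert this using 2
      simp only [hx, hy]
      ring
    subst h5
    exact hQ.eq_point hf hP

/-- The order of `P` divides `m`; a proper divisor would be less than `n`, which forces `b = 0`. -/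
theorem hasOrder_of_nsmul_eq_zero (hf : IsAdmissible d f) {O P : Point d f} (hO : O.IsInfinite)
    {a b : K} (hP : P.HasCoords a b) (hb : b ≠ 0) {m : ℕ} (hm0 : 0 < m)
    (hm : m < 2 * f.natDegree) (h : m • toJacobian O P = 0) : P.HasOrder m := by
  rw [Point.hasOrder_iff hf hO]
  obtain ⟨e, he⟩ := addOrderOf_dvd_of_nsmul_eq_zero h
  set k := addOrderOf (toJacobian O P) with hk
  have hk0 : 0 < k := Nat.pos_of_ne_zero fun h0 => by rw [h0, zero_mul] at he; omega
  rcases lt_trichotomy e 1 with h1 | h1 | h1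
  · obtain rfl : e = 0 := by omega
    omega
  · rw [he, h1, mul_one]
  · have h2 : k * 2 ≤ k * e := Nat.mul_le_mul_left k h1
    exact absurd (eq_zero_of_nsmul_eq_zero hf hO hP hk0 (by omega)
      (addOrderOf_nsmul_eq_zero _)).1 hb

/-- If `d ℓ (P) - d ℓ (O)` is principal for a point `P = (a, b)` with `b ≠ 0`, and
`n < d ℓ < n + d`, then it is the divisor of a function `y - A(x)` with `deg A = ℓ`, and
`f - A ^ d` is a multiple of `(x - a) ^ (d ℓ)` of degree at most `d ℓ`. -/
theorem exists_eq_pow_add (hf : IsAdmissible d f) {O P : Point d f} (hO : O.IsInfinite)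
    {a b : K} (hP : P.HasCoords a b) (hb : b ≠ 0) (hdn : d ≤ f.natDegree) {l : ℕ}
    (hl : f.natDegree < d * l) (hl' : d * l < f.natDegree + d)
    (h : (d * l) • toJacobian O P = 0) :
    ∃ (A : K[X]) (c : K), A.natDegree = l ∧ A.eval a = b ∧
      f = A ^ d + C c * (X - C a) ^ (d * l) := by
  have hd := hf.two_le
  have hPO := hP.ne_infinite hO
  obtain ⟨p, hp, hpd, hpk, hpP, hpQ⟩ := exists_poly_of_nsmul_eq_zero hf hO hPO h
  have hsupp : ∀ i, p.coeff i ≠ 0 → i ≤ 1 := fun i hi => by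
    by_contra hcon
    have h1 := le_poleOrder (d := d) (n := f.natDegree) hi
    have h2 : f.natDegree * 2 ≤ f.natDegree * i := Nat.mul_le_mul_left _ (by omega)
    omega
  have hp1 : p = C (p.coeff 1) * X + C (p.coeff 0) := by
    refine eq_X_add_C_of_natDegree_le_one ?_
    by_contra hcon
    exact hcon (hsupp _ (leadingCoeff_ne_zero.2 hp))
  have hdeg1 : (p.coeff 1).natDegree = 0 := by
    by_cases h0 : p.coeff 1 = 0
    · rw [h0, natDegree_zero]
    by_contra hcon
    have h1 := le_poleOrder (d := d) (n := f.natDegree) h0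
    have h2 : d * 1 ≤ d * (p.coeff 1).natDegree := Nat.mul_le_mul_left _ (by omega)
    omega
  obtain ⟨e, he⟩ : ∃ e, p.coeff 1 = C e := ⟨_, eq_C_of_natDegree_eq_zero hdeg1⟩
  set B := p.coeff 0 with hB
  have he0 : e ≠ 0 := by
    rintro rfl
    rw [he, C_0, C_0, zero_mul, zero_add] at hp1
    rw [hp1, poleOrder_C] at hpk
    refine hb (eq_zero_of_val_aeval hf hO hP (q := B) (fun h0 => ?_) fun Q h1 h2 => ?_)
    · rw [h0, mul_zero] at hpk; omega
    · rw [← algebraMap_of, ← AdjoinRoot.mk_C, ← hp1]; exact hpQ Q h1 h2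
  have hBdeg : B.natDegree = l := by
    have hmem : p.support.Nonempty := support_nonempty.2 hp
    obtain ⟨i, hi, hsup⟩ := p.support.exists_mem_eq_sup hmem
      fun i => f.natDegree * i + d * (p.coeff i).natDegree
    have h1 : poleOrder f.natDegree d p = _ := hsup
    rw [hpk] at h1
    have hi1 := hsupp i (mem_support_iff.1 hi)
    interval_cases i
    · rw [mul_zero, zero_add] at h1
      exact (Nat.eq_of_mul_eq_mul_left (by omega) h1).symm
    · rw [hdeg1] at h1
      omega
  set x := xFun d f with hx
  set y := yFun d f with hy
  set A := C (-e⁻¹) * B with hA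
  have hAx : aeval x A ∈ Algebra.adjoin K {x, y} := aeval_mem_subalgebra (xFun_mem K) A
  have hval : P.val (y - aeval x A) = WithZero.exp (-((d * l : ℕ) : ℤ)) := by
    have hmk : algebraMap (CoordinateRing d f) (FunctionField d f) (AdjoinRoot.mk _ p) =
        algebraMap K _ e * y + aeval x B := by
      rw [hp1, he, map_add, map_mul, map_add, map_mul, AdjoinRoot.mk_C, AdjoinRoot.mk_C,
        AdjoinRoot.mk_X, algebraMap_of, algebraMap_of, aeval_C]
      rfl
    rw [← hpP, hmk]
    have h1 : algebraMap K (FunctionField d f) e * (y - aeval x A) =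
        algebraMap K _ e * y + aeval x B := by
      have h2 : algebraMap K (FunctionField d f) e ≠ 0 := by simpa using he0
      rw [hA, map_mul, aeval_C, map_neg, map_inv₀]
      field_simp
      ring
    have h2 := congrArg P.val h1
    rwa [map_mul, P.trivial_on_constants e he0, one_mul] at h2
  have hl0 : 0 < d * l := by omega
  have hlt : P.val (y - aeval x A) < 1 := by
    rw [hval, ← WithZero.exp_zero, WithZero.exp_lt_exp]; omega
  have hAdeg : A.natDegree = l := by
    rw [hA, natDegree_C_mul (neg_ne_zero.2 (inv_ne_zero he0)), hBdeg]
  refine ⟨A, (f - A ^ d).coeff (d * l), hAdeg, ?_, ?_⟩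
  · refine (sub_eq_zero.1 (hP.isCentered.eq_zero_of_lt ?_)).symm
    have := P.val.map_sub_lt (P.val.map_add_lt hlt (hP.val_aeval_sub_lt A)) hP.2
    rw [map_sub]
    convert this using 2
    simp only [hx, hy]
    ring
  · have hle : P.val (aeval x (f - A ^ d)) ≤ WithZero.exp (-((d * l : ℕ) : ℤ)) := by
      rw [map_sub, map_pow, hx, ← yFun_pow, ← hx, ← hy,
        ← (Commute.all y (aeval x A)).geom_sum₂_mul, map_mul, hval]
      exact mul_le_of_le_one_left' (hP.val_le_one (sum_mem fun i _ =>
          mul_mem (pow_mem (yFun_mem K) _) (pow_mem hAx _)))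
    have hdvd : (X - C a) ^ (d * l) ∣ f - A ^ d := by
      by_cases h0 : f - A ^ d = 0
      · rw [h0]; exact dvd_zero _
      rw [← le_rootMultiplicity_iff h0]
      rw [hx, hP.val_aeval hf hb h0, WithZero.exp_le_exp] at hle
      omega
    have hmonic : ((X - C a) ^ (d * l)).Monic := (monic_X_sub_C a).pow _
    have hdeg : (f - A ^ d).natDegree ≤ ((X - C a) ^ (d * l)).natDegree := by
      rw [natDegree_pow, natDegree_X_sub_C, mul_one]
      refine (natDegree_sub_le _ _).trans (max_le hl.le ?_)
      rw [natDegree_pow, hAdeg]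
    obtain ⟨q, hq⟩ := hdvd
    have hq0 : q.natDegree = 0 := by
      by_cases h0 : q = 0
      · rw [h0, natDegree_zero]
      rw [hq, hmonic.natDegree_mul' h0] at hdeg
      omega
    rw [eq_C_of_natDegree_eq_zero hq0] at hq
    have hco : (f - A ^ d).coeff (d * l) = q.coeff 0 := by
      have h1 : ((X - C a) ^ (d * l)).coeff (d * l) = 1 := by
        have := hmonic.coeff_natDegree
        rwa [natDegree_pow, natDegree_X_sub_C, mul_one] at this
      rw [hq, coeff_mul_C, h1, one_mul]
    rw [hco]
    linear_combination hq

end Torsion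

/-! ### Rational points -/

section Rational

variable {K₀ K : Type*} [Field K₀] [Field K] [Algebra K₀ K] {d : ℕ} {f₀ : K₀[X]}

/-- The `K₀`-points of the affine curve are the points with coordinates in `K₀`. -/
theorem Point.HasCoords.isRational
    (hf : IsAdmissible d (f₀.map (algebraMap K₀ K)))
    {P : Point d (f₀.map (algebraMap K₀ K))} {a b : K₀}
    (h : P.HasCoords (algebraMap K₀ K a) (algebraMap K₀ K b)) : P.IsRational K₀ := by
  have := hf.isDomain
  have hcent : IsCentered P.val (xFun d (f₀.map (algebraMap K₀ K)))
      (yFun d (f₀.map (algebraMap K₀ K))) a b := by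
    refine ⟨fun c hc => ?_, ?_, ?_⟩
    · rw [IsScalarTower.algebraMap_apply K₀ K]
      exact P.trivial_on_constants _ (by simpa using hc)
    · rw [IsScalarTower.algebraMap_apply K₀ K]
      exact h.1
    · rw [IsScalarTower.algebraMap_apply K₀ K]
      exact h.2
  rintro z ⟨p, hp, q, hq, hqu, hz⟩ hreg
  refine hcent.exists_sub_const_lt_of_frac (d := d) (f := f₀) ?_ ?_ ?_ hp hq hqu.ne_zero hz hreg
  · intro h0
    have := congrArg (algebraMap K₀ K) h0
    rw [map_natCast, map_zero] at this
    exact hf.cast_ne_zero this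
  · exact (separable_map _).1 hf.separable
  · rw [yFun_pow, aeval_map_algebraMap]

theorem mem_rationalFunctions [IsDomain (CoordinateRing d (f₀.map (algebraMap K₀ K)))]
    {z : FunctionField d (f₀.map (algebraMap K₀ K))}
    (hz : z ∈ Algebra.adjoin K₀ {xFun d (f₀.map (algebraMap K₀ K)),
      yFun d (f₀.map (algebraMap K₀ K))}) : z ∈ rationalFunctions K₀ d _ :=
  ⟨z, hz, 1, one_mem _, isUnit_one, mul_one z⟩

theorem Point.IsRational.exists_coords (hf : IsAdmissible d (f₀.map (algebraMap K₀ K)))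
    [IsAlgClosed K] {P : Point d (f₀.map (algebraMap K₀ K))} (hP : P.IsRational K₀)
    (hPi : ¬ P.IsInfinite) :
    ∃ a b : K₀, P.HasCoords (algebraMap K₀ K a) (algebraMap K₀ K b) := by
  have := hf.isDomain
  obtain ⟨α, β, h⟩ := Point.exists_hasCoords hf hPi
  obtain ⟨a, ha⟩ := hP _ (mem_rationalFunctions (xFun_mem K₀)) (h.val_le_one (xFun_mem K))
  obtain ⟨b, hb⟩ := hP _ (mem_rationalFunctions (yFun_mem K₀)) (h.val_le_one (yFun_mem K))
  rw [IsScalarTower.algebraMap_apply K₀ K] at ha hb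
  exact ⟨a, b, ha, hb⟩

end Rational

/-! ### Isomorphisms of curves -/

section Isomorphism

/-- Two normalized discrete valuations with the same valuation ring coincide. -/
theorem eq_of_val_le_one_iff {L : Type*} [Field L] {v w : Valuation L ℤᵐ⁰}
    (hv : Function.Surjective v) (hw : Function.Surjective w)
    (h : ∀ z, v z ≤ 1 ↔ w z ≤ 1) : v = w := by
  have he : v.IsEquiv w := Valuation.isEquiv_of_val_le_one h
  obtain ⟨t, ht⟩ := hv (WithZero.exp (-1))
  obtain ⟨s, hs⟩ := hw (WithZero.exp (-1))
  have hle : ∀ (u : Valuation L ℤᵐ⁰) (z : L), u z < 1 → u z ≤ WithZero.exp (-1) := fun u z hz => by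
    by_cases h0 : u z = 0
    · simp [h0]
    rw [← WithZero.exp_log h0] at hz ⊢
    rw [← WithZero.exp_zero, WithZero.exp_lt_exp] at hz
    rw [WithZero.exp_le_exp]
    omega
  have hexp : (WithZero.exp (-1) : ℤᵐ⁰) < 1 := by
    rw [← WithZero.exp_zero, WithZero.exp_lt_exp]; omega
  -- A uniformizer of `v` is one of `w`, being an element of largest value below `1`.
  have hwt : w t = WithZero.exp (-1) := by
    refine le_antisymm (hle w t (he.lt_one_iff_lt_one.1 (ht ▸ hexp))) ?_
    have h1 : v s ≤ v t := ht ▸ hle v s (he.lt_one_iff_lt_one.2 (hs ▸ hexp))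
    exact hs ▸ (he s t).1 h1
  have ht0 : t ≠ 0 := by
    rintro rfl
    rw [map_zero] at ht
    exact WithZero.exp_ne_zero ht.symm
  ext z
  by_cases hz : z = 0
  · simp [hz]
  have hv0 := v.ne_zero_iff.2 hz
  set k := WithZero.log (v z) with hk
  have hpow : (WithZero.exp (-1) : ℤᵐ⁰) ^ k = (WithZero.exp k)⁻¹ := by
    rw [← WithZero.exp_zsmul, ← WithZero.exp_neg]
    congr 1
    simp
  have h1 : v (z * t ^ k) = 1 := by
    rw [map_mul, map_zpow₀, ht, hpow, hk, WithZero.exp_log hv0, mul_inv_cancel₀ hv0]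
  have h2 := he.eq_one_iff_eq_one.1 h1
  rw [map_mul, map_zpow₀, hwt, hpow, hk, WithZero.exp_log hv0] at h2
  exact (eq_of_mul_inv_eq_one h2).symm

section Transport

variable {K : Type*} [Field K] {d : ℕ} {f g : K[X]}

/-- The image of a point under the isomorphism of curves whose pullback of functions is `φ`. -/
def Point.map (φ : FunctionField d g ≃ₐ[K] FunctionField d f) (P : Point d f) : Point d g where
  val := P.val.comap (φ : FunctionField d g →+* FunctionField d f)
  surjective := fun γ => by
    obtain ⟨z, hz⟩ := P.surjective γ
    exact ⟨φ.symm z, by simpa using hz⟩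
  trivial_on_constants := fun c hc => by
    rw [Valuation.comap_apply]
    simpa using P.trivial_on_constants c hc

theorem Point.map_val (φ : FunctionField d g ≃ₐ[K] FunctionField d f) (P : Point d f)
    (z : FunctionField d g) : (P.map φ).val z = P.val (φ z) := rfl

/-- An isomorphism of function fields induces a bijection of points. -/
def pointEquiv (φ : FunctionField d g ≃ₐ[K] FunctionField d f) : Point d f ≃ Point d g where
  toFun := Point.map φ
  invFun := Point.map φ.symm
  left_inv := fun P => Point.ext_val <| Valuation.ext fun z => by
    rw [Point.map_val, Point.map_val, AlgEquiv.apply_symm_apply]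
  right_inv := fun P => Point.ext_val <| Valuation.ext fun z => by
    rw [Point.map_val, Point.map_val, AlgEquiv.symm_apply_apply]

theorem hasOrder_of_val_eq (hf : IsAdmissible d f) (hg : IsAdmissible d g)
    (e : Point d f ≃ Point d g) (φ : FunctionField d g ≃ₐ[K] FunctionField d f)
    (hval : ∀ P z, (e P).val z = P.val (φ z)) (hO : ∀ O, O.IsInfinite → (e O).IsInfinite)
    {P : Point d f} {m : ℕ} (h : (e P).HasOrder m) : P.HasOrder m := by
  have := hf.isDomain
  have := hg.isDomain
  obtain ⟨O, hOi⟩ := exists_isInfinite hf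
  rw [Point.hasOrder_iff hg (hO O hOi)] at h
  rw [Point.hasOrder_iff hf hOi, ← h, addOrderOf_eq_addOrderOf_iff]
  intro k
  by_cases hPO : P = O
  · simp [hPO, toJacobian_self]
  rw [nsmul_toJacobian_eq_zero_iff_val hPO,
    nsmul_toJacobian_eq_zero_iff_val (fun h => hPO (e.injective h))]
  constructor
  · rintro ⟨z, h1, h2, h3⟩
    refine ⟨φ.symm z, ?_, ?_, fun Q hQP hQO => ?_⟩
    · rw [hval, φ.apply_symm_apply, h1]
    · rw [hval, φ.apply_symm_apply, h2]
    · obtain ⟨Q, rfl⟩ := e.surjective Q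
      rw [hval, φ.apply_symm_apply]
      exact h3 Q (fun h => hQP (h ▸ rfl)) (fun h => hQO (h ▸ rfl))
  · rintro ⟨z, h1, h2, h3⟩
    refine ⟨φ z, ?_, ?_, fun Q hQP hQO => ?_⟩
    · rw [← hval, h1]
    · rw [← hval, h2]
    · rw [← hval]
      exact h3 (e Q) (fun h => hQP (e.injective h)) (fun h => hQO (e.injective h))

end Transport

section Iso

variable {K₀ K : Type*} [Field K₀] [Field K] [Algebra K₀ K] {d : ℕ} {f g : K[X]}

theorem Iso.val_toEquiv (hg : IsAdmissible d g) (Ψ : Iso K₀ d f g)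
    (P : Point d f) (z : FunctionField d g) :
    (Ψ.toEquiv P).val z = P.val (Ψ.pullback z) := by
  have := hg.isDomain
  have h := eq_of_val_le_one_iff (Ψ.toEquiv P).surjective (P.map Ψ.pullback).surjective
    (Ψ.regular_iff P)
  rw [h, Point.map_val]

theorem Iso.isRational (hg : IsAdmissible d g) (Ψ : Iso K₀ d f g)
    {P : Point d f} (h : (Ψ.toEquiv P).IsRational K₀) : P.IsRational K₀ := by
  intro z hz hreg
  rw [← Ψ.defined_over] at hz
  obtain ⟨z, hz, rfl⟩ := hz
  obtain ⟨c, hc⟩ := h z hz ((Ψ.regular_iff P z).2 hreg)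
  refine ⟨c, ?_⟩
  have h1 : (Ψ.toEquiv P).val (z - algebraMap K₀ _ c) < 1 := hc
  rw [Ψ.val_toEquiv hg, map_sub, IsScalarTower.algebraMap_apply K₀ K, AlgEquiv.commutes,
    ← IsScalarTower.algebraMap_apply] at h1
  exact h1

theorem Iso.hasOrder (hf : IsAdmissible d f) (hg : IsAdmissible d g) (Ψ : Iso K₀ d f g)
    (hO : ∀ O : Point d f, O.IsInfinite → (Ψ.toEquiv O).IsInfinite)
    {P : Point d f} {m : ℕ} (h : (Ψ.toEquiv P).HasOrder m) : P.HasOrder m :=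
  hasOrder_of_val_eq hf hg Ψ.toEquiv Ψ.pullback (Ψ.val_toEquiv hg) hO h

theorem image_rationalFunctions_subset
    (φ : FunctionField d g ≃ₐ[K] FunctionField d f)
    (hx : φ (xFun d g) ∈ Algebra.adjoin K₀ {xFun d f, yFun d f})
    (hy : φ (yFun d g) ∈ Algebra.adjoin K₀ {xFun d f, yFun d f}) :
    φ '' rationalFunctions K₀ d g ⊆ rationalFunctions K₀ d f := by
  have hmem : ∀ z ∈ Algebra.adjoin K₀ {xFun d g, yFun d g},
      φ z ∈ Algebra.adjoin K₀ {xFun d f, yFun d f} := by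
    intro z hz
    induction hz using Algebra.adjoin_induction with
    | mem z hz => rcases hz with rfl | rfl <;> assumption
    | algebraMap c =>
      rw [IsScalarTower.algebraMap_apply K₀ K, AlgEquiv.commutes,
        ← IsScalarTower.algebraMap_apply]
      exact Subalgebra.algebraMap_mem _ _
    | add r s _ _ hr hs => rw [map_add]; exact add_mem hr hs
    | mul r s _ _ hr hs => rw [map_mul]; exact mul_mem hr hs
  rintro _ ⟨z, ⟨p, hp, q, hq, hqu, h⟩, rfl⟩
  exact ⟨φ p, hmem p hp, φ q, hmem q hq, hqu.map φ, by rw [← map_mul, h]⟩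

/-- The isomorphism of curves with a given pullback of functions. -/
def Iso.ofAlgEquiv (φ : FunctionField d g ≃ₐ[K] FunctionField d f)
    (h : φ '' rationalFunctions K₀ d g = rationalFunctions K₀ d f) : Iso K₀ d f g where
  toEquiv := pointEquiv φ
  pullback := φ
  regular_iff := fun _ _ => Iff.rfl
  defined_over := h

end Iso

section AffineChange

variable {K : Type*} [Field K] {d : ℕ}

/-- The homomorphism of coordinate rings `x ↦ x - α`, `y ↦ β⁻¹ y`. -/
def changeHom (f g : K[X]) (α β : K) (hβ : β ≠ 0) (H : f = C (β ^ d) * g.comp (X - C α)) :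
    CoordinateRing d g →ₐ[K] CoordinateRing d f :=
  AdjoinRoot.liftAlgHom (X ^ d - C g)
    (aeval (AdjoinRoot.of (X ^ d - C f) (X - C α)))
    (algebraMap K _ β⁻¹ * AdjoinRoot.root (X ^ d - C f)) (by
      have h1 : aeval (AdjoinRoot.of (X ^ d - C f) (X - C α)) g =
          AdjoinRoot.of (X ^ d - C f) (g.comp (X - C α)) := by
        have h2 : (AdjoinRoot.of (X ^ d - C f)) = algebraMap K[X] (CoordinateRing d f) := rfl
        rw [h2, aeval_algebraMap_apply]
        rfl
      have h3 : g.comp (X - C α) = C (β⁻¹ ^ d) * f := by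
        conv_rhs => rw [H]
        rw [← mul_assoc, ← C_mul, ← mul_pow, inv_mul_cancel₀ hβ, one_pow, C_1, one_mul]
      rw [eval₂_sub, eval₂_X_pow, eval₂_C, mul_pow, root_pow, AlgHom.coe_toRingHom, h1, h3,
        map_mul, ← map_pow]
      exact sub_self _)

variable {f g : K[X]} {α β : K} {hβ : β ≠ 0} {H : f = C (β ^ d) * g.comp (X - C α)}

theorem changeHom_x : changeHom f g α β hβ H (AdjoinRoot.of _ X) =
    AdjoinRoot.of _ X - algebraMap K _ α := by
  rw [changeHom, AdjoinRoot.liftAlgHom_of, aeval_X, map_sub]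
  rfl

theorem changeHom_y : changeHom f g α β hβ H (AdjoinRoot.root _) =
    algebraMap K _ β⁻¹ * AdjoinRoot.root _ := by
  rw [changeHom, AdjoinRoot.liftAlgHom_root]

theorem coordinateRing_algHom_ext {A : Type*} [CommRing A] [Algebra K A]
    {φ ψ : CoordinateRing d g →ₐ[K] A} (hx : φ (AdjoinRoot.of _ X) = ψ (AdjoinRoot.of _ X))
    (hy : φ (AdjoinRoot.root _) = ψ (AdjoinRoot.root _)) : φ = ψ := by
  refine AdjoinRoot.algHom_ext' ?_ hy
  ext
  exact hx

/-- The isomorphism of function fields `x ↦ x - α`, `y ↦ β⁻¹ y`, for curves whose equations are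
related by this change of variables. -/
theorem exists_changeEquiv (hβ : β ≠ 0) (H : f = C (β ^ d) * g.comp (X - C α)) :
    ∃ φ : FunctionField d g ≃ₐ[K] FunctionField d f,
      φ (xFun d g) = xFun d f - algebraMap K _ α ∧
      φ (yFun d g) = algebraMap K _ β⁻¹ * yFun d f ∧
      φ.symm (xFun d f) = xFun d g + algebraMap K _ α ∧
      φ.symm (yFun d f) = algebraMap K _ β * yFun d g := by
  have H' : g = C (β⁻¹ ^ d) * f.comp (X - C (-α)) := by
    rw [H, mul_comp, comp_assoc]
    simp only [sub_comp, X_comp, C_comp, C_neg]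
    rw [← mul_assoc, ← C_mul, ← mul_pow, inv_mul_cancel₀ hβ]
    simp
  have hL : ∀ c : K, algebraMap (CoordinateRing d f) (FunctionField d f) (algebraMap K _ c) =
      algebraMap K _ c := fun c => (IsScalarTower.algebraMap_apply _ _ _ _).symm
  have hL' : ∀ c : K, algebraMap (CoordinateRing d g) (FunctionField d g) (algebraMap K _ c) =
      algebraMap K _ c := fun c => (IsScalarTower.algebraMap_apply _ _ _ _).symm
  let e : CoordinateRing d g ≃ₐ[K] CoordinateRing d f :=
    AlgEquiv.ofAlgHom (changeHom f g α β hβ H) (changeHom g f (-α) β⁻¹ (inv_ne_zero hβ) H')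
      (coordinateRing_algHom_ext (by
        rw [AlgHom.comp_apply, changeHom_x, map_sub, changeHom_x, AlgHom.commutes]
        simp) (by
        rw [AlgHom.comp_apply, changeHom_y, map_mul, changeHom_y, AlgHom.commutes, ← mul_assoc,
          ← map_mul, inv_inv, mul_inv_cancel₀ hβ, map_one, one_mul]
        rfl))
      (coordinateRing_algHom_ext (by
        rw [AlgHom.comp_apply, changeHom_x, map_sub, changeHom_x, AlgHom.commutes]
        simp) (by
        rw [AlgHom.comp_apply, changeHom_y, map_mul, changeHom_y, AlgHom.commutes, ← mul_assoc,
          ← map_mul, inv_inv, inv_mul_cancel₀ hβ, map_one, one_mul]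
        rfl))
  have he : ∀ r, e r = changeHom f g α β hβ H r := fun _ => rfl
  have he' : ∀ r, e.symm r = changeHom g f (-α) β⁻¹ (inv_ne_zero hβ) H' r := fun _ => rfl
  refine ⟨IsFractionRing.algEquivOfAlgEquiv e, ?_, ?_, ?_, ?_⟩
  · rw [xFun, IsFractionRing.algEquivOfAlgEquiv_algebraMap]
    rw [he, changeHom_x, map_sub, hL]
    rfl
  · rw [yFun, IsFractionRing.algEquivOfAlgEquiv_algebraMap]
    rw [he, changeHom_y, map_mul, hL]
    rfl
  · rw [IsFractionRing.algEquivOfAlgEquiv_symm, xFun, IsFractionRing.algEquivOfAlgEquiv_algebraMap]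
    rw [he', changeHom_x, map_sub, hL', map_neg, sub_neg_eq_add]
    rfl
  · rw [IsFractionRing.algEquivOfAlgEquiv_symm, yFun, IsFractionRing.algEquivOfAlgEquiv_algebraMap]
    rw [he', changeHom_y, map_mul, hL', inv_inv]
    rfl

end AffineChange

/-- If `f(x) = β ^ d g(x - α)` with `α, β ∈ K₀`, then `(x, y) ↦ (x - α, y / β)` is an isomorphism
of curves over `K₀` that respects the infinite points and sends `(α, β)` to `(0, 1)`. -/
theorem exists_iso {K₀ K : Type*} [Field K₀] [Field K] [Algebra K₀ K] {d : ℕ} {f g : K₀[X]}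
    {α β : K₀} (hβ : β ≠ 0) (H : f = C (β ^ d) * g.comp (X - C α))
    (hf : IsAdmissible d (f.map (algebraMap K₀ K)))
    {P : Point d (f.map (algebraMap K₀ K))}
    (hP : P.HasCoords (algebraMap K₀ K α) (algebraMap K₀ K β)) :
    ∃ Ψ : Iso K₀ d (f.map (algebraMap K₀ K)) (g.map (algebraMap K₀ K)), Ψ.Normalizes P := by
  have := hf.isDomain
  have hβ' : algebraMap K₀ K β ≠ 0 := by simpa using hβ
  obtain ⟨φ, hφx, hφy, hφx', hφy'⟩ := exists_changeEquiv (d := d) (α := algebraMap K₀ K α)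
    (f := f.map (algebraMap K₀ K)) (g := g.map (algebraMap K₀ K)) hβ' (by
      conv_lhs => rw [H]
      simp [Polynomial.map_comp])
  have hrat : φ '' rationalFunctions K₀ d (g.map (algebraMap K₀ K)) =
      rationalFunctions K₀ d (f.map (algebraMap K₀ K)) := by
    refine (image_rationalFunctions_subset φ ?_ ?_).antisymm fun z hz => ?_
    · rw [hφx, ← IsScalarTower.algebraMap_apply]
      exact sub_mem (xFun_mem K₀) (Subalgebra.algebraMap_mem _ _)
    · rw [hφy, ← map_inv₀, ← IsScalarTower.algebraMap_apply]
      exact mul_mem (Subalgebra.algebraMap_mem _ _) (yFun_mem K₀)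
    · refine ⟨φ.symm z, image_rationalFunctions_subset φ.symm ?_ ?_ ⟨z, hz, rfl⟩,
        φ.apply_symm_apply z⟩
      · rw [hφx', ← IsScalarTower.algebraMap_apply]
        exact add_mem (xFun_mem K₀) (Subalgebra.algebraMap_mem _ _)
      · rw [hφy', ← IsScalarTower.algebraMap_apply]
        exact mul_mem (Subalgebra.algebraMap_mem _ _) (yFun_mem K₀)
  refine ⟨Iso.ofAlgEquiv φ hrat, fun O hO hreg => hO ?_, ?_, ?_⟩
  · have h1 : O.val (φ (xFun d _)) ≤ 1 := hreg
    rw [hφx] at h1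
    have h2 : O.val (algebraMap K _ (algebraMap K₀ K α)) ≤ 1 := by
      by_cases h0 : algebraMap K₀ K α = 0
      · rw [h0, map_zero, map_zero]; exact zero_le_one
      · exact (O.trivial_on_constants _ h0).le
    have h3 := O.val.map_add_le h1 h2
    rwa [sub_add_cancel] at h3
  · show P.val (φ (xFun d _ - _)) < 1
    rw [map_zero, sub_zero, hφx]
    exact hP.1
  · show P.val (φ (yFun d _ - _)) < 1
    have h1 : φ (yFun d (g.map (algebraMap K₀ K)) - algebraMap K _ 1) =
        algebraMap K _ (algebraMap K₀ K β)⁻¹ * (yFun d _ - algebraMap K _ (algebraMap K₀ K β)) := by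
      rw [map_sub, hφy, AlgEquiv.commutes, mul_sub, ← map_mul, inv_mul_cancel₀ hβ']
    rw [h1, map_mul, P.trivial_on_constants _ (inv_ne_zero hβ'), one_mul]
    exact hP.2

end Isomorphism

/-! ### The polynomials `(B x ^ ℓ + r) ^ d - B ^ d x ^ (d ℓ)` -/

section Versal

variable {k : Type*} [Field k]

/-- `u ^ d - v ^ d = r (u ^ (d - 1) + ⋯ + v ^ (d - 1))` for `u = B x ^ ℓ + r` and `v = B x ^ ℓ`,
and the second factor has leading term `d B ^ (d - 1) x ^ ((d - 1) ℓ)`. -/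
theorem natDegree_add_pow_sub_pow {d l : ℕ} (hd : (d : k) ≠ 0) {B : k} (hB : B ≠ 0) {r : k[X]}
    (hr0 : r ≠ 0) (hr : r.natDegree < l) :
    ((C B * X ^ l + r) ^ d - (C B * X ^ l) ^ d).natDegree = r.natDegree + (d - 1) * l := by
  set u := C B * X ^ l + r with hu
  set v := C B * X ^ l with hv
  have hvdeg : v.natDegree ≤ l := natDegree_C_mul_X_pow_le B l
  have hudeg : u.natDegree ≤ l := natDegree_add_le_of_degree_le hvdeg hr.le
  have hvc : v.coeff l = B := by simp [hv]
  have huc : u.coeff l = B := by rw [hu, coeff_add, hvc, coeff_eq_zero_of_natDegree_lt hr, add_zero]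
  have hle : ∀ i ∈ Finset.range d, (u ^ i * v ^ (d - 1 - i)).natDegree ≤ (d - 1) * l := by
    intro i hi
    rw [Finset.mem_range] at hi
    refine natDegree_mul_le.trans ?_
    have h1 := natDegree_pow_le_of_le i hudeg
    have h2 := natDegree_pow_le_of_le (d - 1 - i) hvdeg
    refine (add_le_add h1 h2).trans ?_
    rw [← add_mul]
    exact Nat.mul_le_mul_right l (by omega)
  have hco : ∀ i ∈ Finset.range d, (u ^ i * v ^ (d - 1 - i)).coeff ((d - 1) * l) = B ^ (d - 1) := by
    intro i hi
    rw [Finset.mem_range] at hi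
    have h0 : (d - 1) * l = i * l + (d - 1 - i) * l := by rw [← add_mul]; congr 1; omega
    rw [h0, coeff_mul_add_eq_of_natDegree_le (natDegree_pow_le_of_le i hudeg)
      (natDegree_pow_le_of_le _ hvdeg), coeff_pow_of_natDegree_le hudeg,
      coeff_pow_of_natDegree_le hvdeg, huc, hvc, ← pow_add]
    congr 1; omega
  have hs : (∑ i ∈ Finset.range d, u ^ i * v ^ (d - 1 - i)).natDegree = (d - 1) * l := by
    refine natDegree_eq_of_le_of_coeff_ne_zero (natDegree_sum_le_of_forall_le _ _ hle) ?_
    rw [finsetSum_coeff, Finset.sum_congr rfl hco, Finset.sum_const, Finset.card_range,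
      nsmul_eq_mul]
    exact mul_ne_zero hd (pow_ne_zero _ hB)
  have hs0 : (∑ i ∈ Finset.range d, u ^ i * v ^ (d - 1 - i)) ≠ 0 := by
    intro h0
    have h1 : (∑ i ∈ Finset.range d, u ^ i * v ^ (d - 1 - i)).coeff ((d - 1) * l) = 0 := by
      rw [h0, coeff_zero]
    rw [finsetSum_coeff, Finset.sum_congr rfl hco, Finset.sum_const, Finset.card_range,
      nsmul_eq_mul] at h1
    exact mul_ne_zero hd (pow_ne_zero _ hB) h1
  rw [← (Commute.all u v).geom_sum₂_mul,
    natDegree_mul hs0 (by rw [hu, add_sub_cancel_left]; exact hr0), hs, hu,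
    add_sub_cancel_left, add_comm]

/-- Comparing degrees, the polynomial `A` in `f = A ^ d + c x ^ (d ℓ)` is the sum of a monomial of
degree `ℓ` and a polynomial of degree `1` if `f` has degree `(d - 1) ℓ + 1`. -/
theorem exists_eq_of_eq_pow_add {d l : ℕ} (hd : (d : k) ≠ 0) (hl : 2 ≤ l) {F A : k[X]} {c : k}
    (hA : A.natDegree = l) (hF : F = A ^ d + C c * X ^ (d * l))
    (hdeg : F.natDegree = (d - 1) * l + 1) :
    ∃ B B₁ : k, B ≠ 0 ∧ B₁ ≠ 0 ∧
      F = -C (B ^ d) * X ^ (d * l) + (C B * X ^ l + C B₁ * X + C (A.eval 0)) ^ d := by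
  have hd0 : d ≠ 0 := by rintro rfl; simp at hd
  set B := A.leadingCoeff with hB
  have hB0 : B ≠ 0 := by
    rw [hB, leadingCoeff_ne_zero]
    rintro rfl
    rw [natDegree_zero] at hA
    omega
  set r := A.eraseLead with hr
  have hAr : A = C B * X ^ l + r := by
    have := A.eraseLead_add_C_mul_X_pow
    rw [hA] at this
    rw [← this, add_comm]
  have hc : c = -B ^ d := by
    have h1 : F.coeff (d * l) = 0 := coeff_eq_zero_of_natDegree_lt (by
      rw [hdeg]
      obtain ⟨e, rfl⟩ := Nat.exists_eq_succ_of_ne_zero hd0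
      rw [Nat.succ_sub_one, Nat.succ_mul]
      omega)
    rw [hF, coeff_add, coeff_pow_of_natDegree_le hA.le, coeff_C_mul_X_pow, if_pos rfl] at h1
    have h2 : A.coeff l = B := by rw [hB, leadingCoeff, hA]
    rw [h2] at h1
    linear_combination h1
  have hF' : F = (C B * X ^ l + r) ^ d - (C B * X ^ l) ^ d := by
    rw [hF, hc, hAr, mul_pow, ← pow_mul, ← C_pow, C_neg, C_pow, mul_comm l d]
    ring
  have hr0 : r ≠ 0 := by
    intro h0
    rw [h0, add_zero, sub_self] at hF'
    rw [hF', natDegree_zero] at hdeg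
    omega
  have hrl : r.natDegree < l := by
    rcases A.eraseLead_natDegree_lt_or_eraseLead_eq_zero with h | h
    · rwa [hA] at h
    · exact absurd h hr0
  have hrdeg : r.natDegree = 1 := by
    have := natDegree_add_pow_sub_pow hd hB0 hr0 hrl
    rw [← hF', hdeg] at this
    omega
  have hr1 := eq_X_add_C_of_natDegree_le_one hrdeg.le
  have hr00 : r.coeff 0 = A.eval 0 := by
    conv_rhs => rw [hAr]
    rw [eval_add, eval_mul, eval_pow, eval_X, zero_pow (by omega), mul_zero, zero_add,
      coeff_zero_eq_eval_zero]
  refine ⟨B, r.coeff 1, hB0, ?_, ?_⟩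
  · rw [← hrdeg]
    exact leadingCoeff_ne_zero.2 hr0
  · rw [← hr00, add_assoc, ← hr1, hF', mul_pow, ← pow_mul, mul_comm l d, C_pow]
    ring

/-- The coefficients of `f = -B ^ d x ^ (d ℓ) + (B x ^ ℓ + B₁ x + b) ^ d` in degrees `1` and `ℓ`
are `d b ^ (d - 1) B₁` and `d b ^ (d - 1) B` plus a polynomial in `b` and `B₁`, so `B₁` and `B`
lie in any field that contains `b` and the coefficients of `f`. -/
theorem exists_descent {k' : Type*} [Field k'] (ι : k →+* k') {d l : ℕ} (hd : (d : k) ≠ 0)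
    (hd2 : 2 ≤ d) (hl : 2 ≤ l) {T : k[X]} {b : k} (hb : b ≠ 0) {B B₁ : k'}
    (hT : T.map ι = -C (B ^ d) * X ^ (d * l) + (C B * X ^ l + C B₁ * X + C (ι b)) ^ d) :
    ∃ β β₁ : k, ι β = B ∧ ι β₁ = B₁ ∧
      T = -C (β ^ d) * X ^ (d * l) + (C β * X ^ l + C β₁ * X + C b) ^ d := by
  have hdl : 2 * l ≤ d * l := Nat.mul_le_mul_right l hd2
  set e := (d : k) * b ^ (d - 1) with he
  have he0 : e ≠ 0 := mul_ne_zero hd (pow_ne_zero _ hb)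
  have hιe : ι e = d * ι b ^ (d - 1) := by rw [he, map_mul, map_natCast, map_pow]
  have hB₁ : ι (T.coeff 1) = ι e * B₁ := by
    have h1 : (T.map ι).coeff 1 = (derivative (T.map ι)).eval 0 := by
      rw [← coeff_zero_eq_eval_zero, coeff_derivative]; simp
    rw [← coeff_map, h1, hT, hιe]
    simp only [derivative_add, derivative_mul, derivative_neg, derivative_C,
      derivative_pow, derivative_X, eval_add, eval_mul, eval_neg, eval_C, eval_pow, eval_X]
    rw [zero_pow (by omega : d * l ≠ 0), zero_pow (by omega : d * l - 1 ≠ 0),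
      zero_pow (by omega : l ≠ 0), zero_pow (by omega : l - 1 ≠ 0)]
    simp
  set β₁ := T.coeff 1 / e with hβ₁
  have hβ₁' : ι β₁ = B₁ := by
    rw [hβ₁, map_div₀, hB₁]
    exact mul_div_cancel_left₀ _ (by simpa using he0)
  set p : k[X] := C β₁ * X + C b with hp
  have hpι : p.map ι = C B₁ * X + C (ι b) := by simp [hp, hβ₁']
  have hB : ι (T.coeff l) = ι ((p ^ d).coeff l) + ι e * B := by
    obtain ⟨q, hq⟩ := powAddExpansion (p.map ι) (C B * X ^ l) d
    have h1 : T.map ι = -C (B ^ d) * X ^ (d * l) + ((p ^ d).map ι +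
        (d : k'[X]) * (p.map ι) ^ (d - 1) * (C B * X ^ l) + q * (C B * X ^ l) ^ 2) := by
      rw [Polynomial.map_pow, ← hq, hT, hpι]
      ring
    have h2 : (-C (B ^ d) * X ^ (d * l)).coeff l = 0 := by
      rw [← C_neg, coeff_C_mul_X_pow, if_neg (by omega)]
    have h3 : (q * (C B * X ^ l) ^ 2).coeff l = 0 := by
      have : q * (C B * X ^ l) ^ 2 = q * C B ^ 2 * X ^ (2 * l) := by ring
      rw [this, coeff_mul_X_pow', if_neg (by omega)]
    have h4 : ((d : k'[X]) * (p.map ι) ^ (d - 1) * (C B * X ^ l)).coeff l = ι e * B := by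
      have : (d : k'[X]) * (p.map ι) ^ (d - 1) * (C B * X ^ l) =
        ((d : k'[X]) * (p.map ι) ^ (d - 1) * C B) * X ^ l := by ring
      rw [this, coeff_mul_X_pow', if_pos le_rfl, Nat.sub_self, coeff_zero_eq_eval_zero, hpι, hιe]
      simp
    rw [← coeff_map, h1, coeff_add, coeff_add, coeff_add, h2, h3, h4, coeff_map]
    ring
  set β := (T.coeff l - (p ^ d).coeff l) / e with hβ
  have hβ' : ι β = B := by
    rw [hβ, map_div₀, map_sub, hB, add_sub_cancel_left]
    exact mul_div_cancel_left₀ _ (by simpa using he0)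
  refine ⟨β, β₁, hβ', hβ₁', ?_⟩
  apply Polynomial.map_injective ι ι.injective
  rw [hT, ← hβ', ← hβ₁']
  simp

theorem versalPoly_eq (d l : ℕ) (B B₁ : k) : versalPoly d l B B₁ =
    (C B * X ^ l + (C B₁ * X + 1)) ^ d - (C B * X ^ l) ^ d := by
  rw [versalPoly, mul_pow, ← pow_mul, mul_comm l d, C_pow]
  ring

theorem natDegree_versalPoly {d l : ℕ} (hd : (d : k) ≠ 0) (hl : 2 ≤ l) {B B₁ : k} (hB : B ≠ 0)
    (hB₁ : B₁ ≠ 0) : (versalPoly d l B B₁).natDegree = (d - 1) * l + 1 := by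
  have h1 : (C B₁ * X + 1 : k[X]).natDegree = 1 := natDegree_linear hB₁
  rw [versalPoly_eq, natDegree_add_pow_sub_pow hd hB (fun h => by simp [h] at h1) (by omega), h1,
    add_comm]

/-- Scaling `y` by `b` normalizes the constant term of `B x ^ ℓ + B₁ x + b` to `1`. -/
theorem eq_C_mul_versalPoly {d l : ℕ} {β β₁ b : k} (hb : b ≠ 0) :
    -C (β ^ d) * X ^ (d * l) + (C β * X ^ l + C β₁ * X + C b) ^ d =
      C (b ^ d) * versalPoly d l (β / b) (β₁ / b) := by
  have h1 : ∀ c : k, C c = C b * C (c / b) := fun c => by rw [← C_mul, mul_div_cancel₀ _ hb]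
  rw [versalPoly, C_pow, C_pow, C_pow]
  rw [h1 β, h1 β₁, mul_pow]
  have h2 : C b * C (β / b) * X ^ l + C b * C (β₁ / b) * X + C b =
      C b * (C (β / b) * X ^ l + C (β₁ / b) * X + 1) := by ring
  rw [h2, mul_pow]
  ring

end Versal

/-! ### The normal form of curves with a rational point of order `d ℓ` -/

section Main

variable {K₀ K : Type*} [Field K₀] [Field K] [IsAlgClosed K] [Algebra K₀ K]

omit [IsAlgClosed K] in
theorem IsAdmissible.map {d : ℕ} {f : K₀[X]} (h : IsAdmissible d f) :
    IsAdmissible d (f.map (algebraMap K₀ K)) where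
  two_le := h.two_le
  coprime := by rw [natDegree_map]; exact h.coprime
  cast_ne_zero := fun h0 => h.cast_ne_zero <| by
    rw [← map_natCast (algebraMap K₀ K)] at h0
    exact (map_eq_zero_iff _ (algebraMap K₀ K).injective).1 h0
  separable := h.separable.map

/-- On the curve `y ^ d = f_{B, B₁}(x)` of degree `n = (d - 1) ℓ + 1` the point `(0, 1)` is a
`K₀`-point of order `d ℓ`. -/
theorem exists_point_zero_one {d l : ℕ} {B B₁ : K₀} (hl : 2 ≤ l) (hB : B ≠ 0)
    (hdeg : (versalPoly d l B B₁).natDegree = (d - 1) * l + 1)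
    (hg : IsAdmissible d (versalPoly d l B B₁)) :
    ∃ Q : Point d ((versalPoly d l B B₁).map (algebraMap K₀ K)),
      (∀ R, R.HasCoords 0 1 ↔ R = Q) ∧ Q.IsRational K₀ ∧ Q.HasOrder (d * l) := by
  have hgK := hg.map (K := K)
  have := hgK.isDomain
  have hd := hg.two_le
  set A : K₀[X] := C B * X ^ l + C B₁ * X + 1 with hA
  have hAdeg : A.natDegree = l := by
    rw [hA, add_assoc, natDegree_add_eq_left_of_natDegree_lt, natDegree_C_mul_X_pow l B hB]
    rw [natDegree_C_mul_X_pow l B hB]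
    have h1 : (C B₁ * X + 1 : K₀[X]).natDegree ≤ 1 := natDegree_linear_le
    omega
  have hA0 : A.eval 0 = 1 := by
    simp [hA, zero_pow (by omega : l ≠ 0)]
  have hAK0 : (A.map (algebraMap K₀ K)).eval 0 = 1 := by
    rw [← map_zero (algebraMap K₀ K), eval_map, eval₂_at_apply, hA0, map_one]
  have hfA : (versalPoly d l B B₁).map (algebraMap K₀ K) = A.map (algebraMap K₀ K) ^ d +
      C (-(algebraMap K₀ K B) ^ d) * (X - C 0) ^ (d * (A.map (algebraMap K₀ K)).natDegree) := by
    rw [natDegree_map, hAdeg, C_0, sub_zero, versalPoly, ← hA, Polynomial.map_add,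
      Polynomial.map_mul, Polynomial.map_neg, Polynomial.map_pow, Polynomial.map_pow, map_C, map_X,
      C_neg, map_pow]
    ring
  obtain ⟨Q, hQ⟩ := exists_point hgK (a := 0) (b := 1) (by
    rw [hfA, natDegree_map, hAdeg]
    simp [hAK0, zero_pow (by positivity : d * l ≠ 0)])
  obtain ⟨O, hO⟩ := exists_isInfinite hgK
  have hn : (d - 1) * l + l = d * l := by
    rw [← Nat.succ_mul]; congr 1; omega
  refine ⟨Q, fun R => ⟨fun hR => hR.eq_point hgK hQ, fun hR => hR ▸ hQ⟩, ?_, ?_⟩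
  · refine Point.HasCoords.isRational hgK (a := 0) (b := 1) ?_
    rwa [map_zero, map_one]
  · have h1 := nsmul_eq_zero_of_eq_pow_add hgK hO (A := A.map (algebraMap K₀ K))
      (by rw [hAK0]; exact hQ) (by rw [hAK0]; exact one_ne_zero)
      (neg_ne_zero.2 (pow_ne_zero d (by simpa using hB))) hfA (by
        rw [natDegree_map, natDegree_map, hAdeg, hdeg]; omega)
    rw [natDegree_map, hAdeg] at h1
    have h2 : 1 * l ≤ (d - 1) * l := Nat.mul_le_mul_right l (by omega)
    exact hasOrder_of_nsmul_eq_zero hgK hO hQ one_ne_zero (by positivity)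
      (by rw [natDegree_map, hdeg]; omega) h1

/-- On the curve `y ^ d = f_{B, B₁}(x)` the point `(-1 / B₁, 0)` is a `K₀`-point of order `d`. -/
theorem exists_point_root {d l : ℕ} {B B₁ : K₀} (hB₁ : B₁ ≠ 0)
    (hdeg : d ≤ (versalPoly d l B B₁).natDegree)
    (hg : IsAdmissible d (versalPoly d l B B₁)) :
    ∃ Q : Point d ((versalPoly d l B B₁).map (algebraMap K₀ K)),
      (∀ R, R.HasCoords (algebraMap K₀ K (-1 / B₁)) 0 ↔ R = Q) ∧ Q.IsRational K₀ ∧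
        Q.HasOrder d := by
  have hgK := hg.map (K := K)
  have := hgK.isDomain
  have hd := hg.two_le
  have hroot : (versalPoly d l B B₁).eval (-1 / B₁) = 0 := by
    have h1 : B₁ * (-1 / B₁) + 1 = 0 := by field_simp; ring
    rw [versalPoly]
    simp only [eval_add, eval_mul, eval_neg, eval_C, eval_pow, eval_X, eval_one]
    rw [add_assoc, h1, add_zero, mul_pow, ← pow_mul, mul_comm l d]
    ring
  obtain ⟨Q, hQ⟩ := exists_point hgK (a := algebraMap K₀ K (-1 / B₁)) (b := 0) (by
    rw [eval_map, eval₂_at_apply, hroot, map_zero, zero_pow (by omega)])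
  refine ⟨Q, fun R => ⟨fun hR => hR.eq_point hgK hQ, fun hR => hR ▸ hQ⟩, ?_, ?_⟩
  · refine Point.HasCoords.isRational hgK (a := -1 / B₁) (b := 0) ?_
    rwa [map_zero]
  · exact hQ.hasOrder_of_eq_zero hgK (by rwa [natDegree_map])

/-- A curve of degree `n = (d - 1) ℓ + 1` with a `K₀`-point of order `d ℓ` is isomorphic to one of
the curves `y ^ d = f_{B, B₁}(x)`. -/
theorem exists_versal {d l : ℕ} (hl : 2 ≤ l) (hld : l ≤ d) {f : K₀[X]}
    (hdeg : f.natDegree = (d - 1) * l + 1) (hf : IsAdmissible d f)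
    {P : Point d (f.map (algebraMap K₀ K))} (hP : P.IsRational K₀) (hPm : P.HasOrder (d * l)) :
    ∃ B B₁ : K₀, B ≠ 0 ∧ B₁ ≠ 0 ∧ (versalPoly d l B B₁).Separable ∧
      ∃ Ψ : Iso K₀ d (f.map (algebraMap K₀ K)) ((versalPoly d l B B₁).map (algebraMap K₀ K)),
        Ψ.Normalizes P := by
  have hfK := hf.map (K := K)
  have := hfK.isDomain
  have hd := hf.two_le
  have hdl : 2 * 2 ≤ d * l := Nat.mul_le_mul hd hl
  have hn : (d - 1) * l + l = d * l := by
    rw [← Nat.succ_mul]; congr 1; omega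
  have h1l : 1 * l ≤ (d - 1) * l := Nat.mul_le_mul_right l (by omega)
  have h2d : d - 1 ≤ (d - 1) * l := Nat.le_mul_of_pos_right _ (by omega)
  obtain ⟨O, hO⟩ := exists_isInfinite hfK
  rw [Point.hasOrder_iff hfK hO] at hPm
  have hPi : ¬ P.IsInfinite := fun hi => by
    rw [hi.eq_point hfK hO, toJacobian_self, addOrderOf_zero] at hPm
    omega
  obtain ⟨a, b, hab⟩ := hP.exists_coords hfK hPi
  have hb : b ≠ 0 := by
    rintro rfl
    rw [map_zero] at hab
    have h1 := hab.hasOrder_of_eq_zero hfK (by rw [natDegree_map, hdeg]; omega)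
    rw [Point.hasOrder_iff hfK hO, hPm] at h1
    have h2 : d * 2 ≤ d * l := Nat.mul_le_mul_left d hl
    omega
  have hbK : algebraMap K₀ K b ≠ 0 := by simpa using hb
  obtain ⟨A, c, hA, hAb, hfA⟩ := exists_eq_pow_add hfK hO hab hbK
    (by rw [natDegree_map, hdeg]; omega) (l := l)
    (by rw [natDegree_map, hdeg]; omega) (by rw [natDegree_map, hdeg]; omega)
    (by rw [← hPm]; exact addOrderOf_nsmul_eq_zero _)
  -- Move the point to the line `x = 0`.
  set T := f.comp (X + C a) with hT
  have hTf : f = T.comp (X - C a) := by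
    rw [hT, comp_assoc]; simp
  set A₁ := A.comp (X + C (algebraMap K₀ K a)) with hA₁
  have hTK : T.map (algebraMap K₀ K) = A₁ ^ d + C c * X ^ (d * l) := by
    rw [hT, Polynomial.map_comp, hfA]
    simp [hA₁]
  have hA₁deg : A₁.natDegree = l := by
    rw [hA₁, natDegree_comp, natDegree_X_add_C, mul_one, hA]
  have hA₁0 : A₁.eval 0 = algebraMap K₀ K b := by
    rw [hA₁, eval_comp]; simp [hAb]
  obtain ⟨B, B₁, hB, hB₁, hTB⟩ := exists_eq_of_eq_pow_add hfK.cast_ne_zero hl hA₁deg hTK (by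
    rw [natDegree_map, hT, natDegree_comp, natDegree_X_add_C, mul_one, hdeg])
  rw [hA₁0] at hTB
  obtain ⟨β, β₁, rfl, rfl, hTβ⟩ := exists_descent (algebraMap K₀ K) hf.cast_ne_zero hd hl hb hTB
  rw [eq_C_mul_versalPoly hb] at hTβ
  refine ⟨β / b, β₁ / b, div_ne_zero (by simpa using hB) hb, div_ne_zero (by simpa using hB₁) hb,
    ?_, ?_⟩
  · have hTsep : T.Separable := by
      have h1 := IsCoprime.map hf.separable (compRingHom (X + C a))
      rw [coe_compRingHom_apply, coe_compRingHom_apply] at h1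
      rw [Polynomial.Separable, hT, derivative_comp]
      simpa using h1
    rw [hTβ] at hTsep
    exact hTsep.of_mul_right
  · refine exists_iso hb ?_ hfK hab
    conv_lhs => rw [hTf, hTβ]
    simp

end Main

end CyclicCover

end

theorem mainTheorem2 {K₀ K : Type*} [Field K₀] [PerfectField K₀] [Field K] [IsAlgClosed K]
    [Algebra K₀ K] (n d ℓ₀ m₀ : ℕ) (hd : 2 ≤ d) (hdn : d < n) (hcop : n.Coprime d)
    (hchar : ¬ ringChar K₀ ∣ d) (hℓ₀ : ℓ₀ = (n + d) / d) (hm₀ : m₀ = d * ℓ₀)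
    (hone : (n : ℤ) - m₀ + ℓ₀ = 1) (hcharℓ₀ : ¬ ringChar K₀ ∣ ℓ₀)
    (f : K₀[X]) (hdeg : f.natDegree = n) (hsep : f.Separable)
    (P : CyclicCover.Point d (f.map (algebraMap K₀ K))) :
    ((P.IsRational K₀ ∧ P.HasOrder m₀) ↔
      ∃ B B₁ : K₀, B ≠ 0 ∧ B₁ ≠ 0 ∧ (CyclicCover.versalPoly d ℓ₀ B B₁).Separable ∧
        ∃ Ψ : CyclicCover.Iso K₀ d (f.map (algebraMap K₀ K))
          ((CyclicCover.versalPoly d ℓ₀ B B₁).map (algebraMap K₀ K)), Ψ.Normalizes P) ∧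
    ∀ B B₁ : K₀, B ≠ 0 → B₁ ≠ 0 → (CyclicCover.versalPoly d ℓ₀ B B₁).Separable →
      ∀ Ψ : CyclicCover.Iso K₀ d (f.map (algebraMap K₀ K))
        ((CyclicCover.versalPoly d ℓ₀ B B₁).map (algebraMap K₀ K)), Ψ.Normalizes P →
      (∃ Q : CyclicCover.Point d ((CyclicCover.versalPoly d ℓ₀ B B₁).map (algebraMap K₀ K)),
        (∀ R, R.HasCoords 0 1 ↔ R = Q) ∧ Q.IsRational K₀ ∧ Q.HasOrder m₀) ∧
      (∃ Q : CyclicCover.Point d ((CyclicCover.versalPoly d ℓ₀ B B₁).map (algebraMap K₀ K)),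
        (∀ R, R.HasCoords (algebraMap K₀ K (-1 / B₁)) 0 ↔ R = Q) ∧
        Q.IsRational K₀ ∧ Q.HasOrder d ∧
        (Ψ.toEquiv.symm Q).IsRational K₀ ∧ (Ψ.toEquiv.symm Q).HasOrder d) := by
  subst hm₀
  have hdK : (d : K₀) ≠ 0 := fun h => hchar ((ringChar.spec K₀ d).1 h)
  have hl : 2 ≤ ℓ₀ := by
    rw [hℓ₀, Nat.le_div_iff_mul_le (by omega)]; omega
  have hdl : (d - 1) * ℓ₀ + ℓ₀ = d * ℓ₀ := by
    rw [← Nat.succ_mul]; congr 1; omega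
  have hn : n = (d - 1) * ℓ₀ + 1 := by
    push_cast at hone
    zify at hdl ⊢
    linarith
  have hld : ℓ₀ ≤ d := by
    have h1 : d * ℓ₀ ≤ n + d := by rw [hℓ₀]; exact Nat.mul_div_le _ _
    -- Equality would make `n` a multiple of `d`.
    have h2 : d * ℓ₀ ≠ n + d := fun h => by
      have h3 : d ∣ n := (Nat.dvd_add_left dvd_rfl).1 ⟨ℓ₀, h.symm⟩
      have h4 := Nat.Coprime.eq_one_of_dvd hcop.symm h3
      omega
    omega
  have hf : CyclicCover.IsAdmissible d f := ⟨hd, hdeg ▸ hcop, hdK, hsep⟩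
  have hfK := hf.map (K := K)
  have hgdeg : ∀ B B₁ : K₀, B ≠ 0 → B₁ ≠ 0 →
      (CyclicCover.versalPoly d ℓ₀ B B₁).natDegree = n := fun B B₁ hB hB₁ => by
    rw [CyclicCover.natDegree_versalPoly hdK hl hB hB₁, hn]
  have hg : ∀ B B₁ : K₀, B ≠ 0 → B₁ ≠ 0 → (CyclicCover.versalPoly d ℓ₀ B B₁).Separable →
      CyclicCover.IsAdmissible d (CyclicCover.versalPoly d ℓ₀ B B₁) := fun B B₁ hB hB₁ hs =>
    ⟨hd, by rw [hgdeg B B₁ hB hB₁]; exact hcop, hdK, hs⟩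
  refine ⟨⟨fun ⟨hP, hPm⟩ => ?_, ?_⟩, fun B B₁ hB hB₁ hs Ψ hΨ => ⟨?_, ?_⟩⟩
  · exact CyclicCover.exists_versal hl hld (hdeg.trans hn) hf hP hPm
  · rintro ⟨B, B₁, hB, hB₁, hs, Ψ, hΨO, hΨP⟩
    have hgK := (hg B B₁ hB hB₁ hs).map (K := K)
    obtain ⟨Q, hQ, hQr, hQm⟩ := CyclicCover.exists_point_zero_one (K := K) hl hB
      ((hgdeg B B₁ hB hB₁).trans hn) (hg B B₁ hB hB₁ hs)
    obtain rfl := (hQ _).1 hΨP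
    exact ⟨Ψ.isRational hgK hQr, Ψ.hasOrder hfK hgK hΨO hQm⟩
  · exact CyclicCover.exists_point_zero_one hl hB
      ((hgdeg B B₁ hB hB₁).trans hn) (hg B B₁ hB hB₁ hs)
  · have hgK := (hg B B₁ hB hB₁ hs).map (K := K)
    obtain ⟨Q, hQ, hQr, hQd⟩ := CyclicCover.exists_point_root (K := K) hB₁
      (by rw [hgdeg B B₁ hB hB₁]; exact hdn.le) (hg B B₁ hB hB₁ hs)
    refine ⟨Q, hQ, hQr, hQd, Ψ.isRational hgK ?_, Ψ.hasOrder hfK hgK hΨ.1 ?_⟩ <;>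
      rwa [Equiv.apply_symm_apply]
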